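/- **Setting.** All manifolds and maps are smooth and finite-dimensional. Let $H$ be a Lie group, $W\to X$ a principal $H$-bundle over an $n$-dimensional manifold $X$, $F$ an $m$-dimensional manifold with a smooth left action of $H$, and $\pi:Y=W\times_H F\to X$ the associated bundle. (Gauge-natural bundles of order $(r,k)$ are the case $W=W^{(r,k)}P=J_rP\times_X L_k(X)$, $H=W^{(r,k)}G$, for a principal $G$-bundle $P$.) In fibered charts $(x^\sigma,y^i)$ of $Y$ the jet coordinates are $(x^\sigma,y^i_\alpha)$, with $\alpha$ a multi-index, and $D_\sigma=\partial_\sigma+\sum_{\alpha,i}y^i_{\alpha+\sigma}\,\partial^\alpha_i$, $\partial_i^\alpha=\partial/\partial y^i_\alpha$. A Lagrangian of order $s$ is a smooth horizontal $n$-form $\lambda=L\,dx^1\wedge\dots\wedge dx^n$ on $J_sY$, and $\mathcal E_i(\lambda)=E_i(L)=\sum_\alpha(-1)^{|\alpha|}D_\alpha\partial_i^\alpha L$. An infinitesimal principal automorphism $\bar\Xi$ is a right-invariant vector field on the part of $W$ over an open subset of $X$. Its lift to $Y$ is $\mathfrak G(\bar\Xi)([w,f])=\frac{d}{dt}\big|_{0}[\Phi_t(w),f]$,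 where $\Phi_t$ is the flow of $\bar\Xi$. If $\mathfrak G(\bar\Xi)=\xi^\sigma\partial_\sigma+\hat\Xi^i\partial_i$, its vertical part $\mathfrak G(\bar\Xi)_V$ has components $Q^i=\hat\Xi^i-y^i_\sigma\xi^\sigma$; $\mathrm{pr}_Q=\sum_{\alpha,i} D_\alpha Q^i\,\partial^\alpha_i$ denotes the derivative along its prolongation. $\mathfrak G(\bar\Xi)$ is a symmetry of $\lambda$ if the Lie derivative of $\lambda$ along its jet prolongation vanishes, i.e. $\xi^\sigma D_\sigma L+\mathrm{pr}_Q L+L\,\partial_\sigma\xi^\sigma=0$. Let $\mathcal A$ be a family of such fields $\bar\Xi$ (for instance all of them, or all those prolonged from a principal bundle $P$ as above); $\lambda$ is called gauge-natural invariant (with respect to $\mathcal A$) if $\mathfrak G(\bar\Xi)$ is a symmetry of $\lambda$ for every $\bar\Xi\in\mathcal A$. Let $\omega(\lambda,\mathfrak G(\bar\Xi)_V)=-Q^iE_i(L)\,dx^1\wedge\dots\wedge dx^n$. The generalized Bianchi and Jacobi morphisms $\beta$, $\mathcal J$ and the second variation $\delta^2_{\mathfrak G}\lambda$ along $\mathfrak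 G(\bar\Xi)_V$ are taken in each of two senses. * (A) *The variation is an independent, linear argument* (vertical differentials act on $\lambda$ only): $$\beta_i=-\sum_\alpha(-1)^{|\alpha|}D_\alpha\big(Q^j\,\partial_i^\alpha E_j(L)\big),\qquad \mathcal J_i=\sum_\alpha(-1)^{|\alpha|}D_\alpha\Big(\sum_{\mu,j}(\partial_i^\alpha\partial_j^\mu L)\,D_\mu Q^j\Big),$$ and $\delta^2_{\mathfrak G}\lambda$ is the morphism sending a vertical variation $w=w^i(x,y)\partial_i$, given in a fibered chart, to the class, modulo local divergences $D_\sigma\mu^\sigma$, of $\sum_{\alpha,i,\mu,j}(\partial_i^\alpha\partial_j^\mu L)\,D_\mu Q^j\,D_\alpha w^i$; it vanishes if all these classes are zero. * (B) *$Q$ is substituted, as a function on $J_1Y$, before differentiating*: $$\beta_i=E_i(-Q^jE_j(L)),\qquad \mathcal J_i=E_i\big(\mathrm{pr}_Q(\mathrm{pr}_QL)\big),$$ i.e. $\mathcal J=\mathcal E(\mathfrak G(\bar\Xi)_V\rfloor h(d\delta\lambda))$ with $\delta\lambda$ the first variation, and $\delta^2_{\mathfrak G}\lambda$ is the class of $\mathrm{pr}_Q(\mathrm{pr}_QL)$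 modulo local divergences. In each sense let $\mathfrak K$ be the kernel of the Jacobi morphism, i.e. the set of those $\bar\Xi$ with $\mathcal J(\lambda,\mathfrak G(\bar\Xi)_V)=0$. "Vanishing globally" means vanishing in every fibered chart, at every jet lying over the domain of $\bar\Xi$. **Theorem.** Let $\lambda$ be a Lagrangian on $Y$ which is gauge-natural invariant with respect to $\mathcal A$, and let $\bar\Xi\in\mathcal A$. In sense (A), and likewise in sense (B), the following are equivalent: 1. the generalized Bianchi morphism $\beta(\lambda,\mathfrak G(\bar\Xi)_V)$ vanishes globally; 2. the second variation $\delta^2_{\mathfrak G}\lambda$ along $\mathfrak G(\bar\Xi)_V$ vanishes; 3. the generalized Jacobi morphism $\mathcal J(\lambda,\mathfrak G(\bar\Xi)_V)$ vanishes globally; 4. $\mathfrak G(\bar\Xi)_V$ belongs to the kernel $\mathfrak K$ of the Jacobi morphism, i.e. $\bar\Xi\in\mathfrak K$. In sense (B) these are also equivalent to the global vanishing of $\mathfrak G(\bar\Xi)_V\rfloor\mathcal E\big(\mathfrak G(\bar\Xi)_V\rfloor\mathcal E(\lambda)\big)$. -/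

import Mathlib

open scoped ContDiff Manifold Topology

noncomputable section

namespace GaugeNatural

/-! ## Calculus on jet coordinates

`n` independent variables `x^σ`, `m` dependent variables `y^i`.  A multi-index is a function
`α : Fin n → ℕ`; a point of the jet space is given by its coordinates `(x^σ, y^i_α)`. -/

/-- Jet coordinates: `p.1 σ` is `x^σ` and `p.2 α i` is `y^i_α`. -/
abbrev Jet (n m : ℕ) : Type := (Fin n → ℝ) × ((Fin n → ℕ) → Fin m → ℝ)

/-- `α_1 + … + α_n`. -/
def degree {n : ℕ} (α : Fin n → ℕ) : ℕ := ∑ σ, α σ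

/-- The finite set of multi-indices of degree at most `k`. -/
def multiIndices (n k : ℕ) : Finset (Fin n → ℕ) :=
  (Fintype.piFinset fun _ : Fin n => Finset.range (k + 1)).filter fun α => degree α ≤ k

theorem zero_mem_multiIndices (n k : ℕ) : (0 : Fin n → ℕ) ∈ multiIndices n k := by
  refine Finset.mem_filter.2 ⟨?_, ?_⟩
  · simp
  · simp [degree]

/-- For commuting operators `D_1, …, D_n`, the operator `D_α = D_1^{α_1} ⋯ D_n^{α_n}`. -/
def iter {n : ℕ} {T : Type*} (D : Fin n → T → T) (α : Fin n → ℕ) (f : T) : T :=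
  (List.finRange n).foldr (fun σ g => (D σ)^[α σ] g) f

section Coordinates

variable {n m : ℕ}

/-- The jets lying over a set of the `(x, y)`-space. -/
def jetsOver (O : Set ((Fin n → ℝ) × (Fin m → ℝ))) : Set (Jet n m) :=
  {p | (p.1, p.2 0) ∈ O}

/-- `f` is, over `O`, a smooth function on the jet space of order `k`: it depends only on the
coordinates `x^σ`, `y^i_α` with `|α| ≤ k`, and smoothly so. -/
def IsJetSmooth (k : ℕ) (O : Set ((Fin n → ℝ) × (Fin m → ℝ))) (f : Jet n m → ℝ) : Prop :=
  ∃ g : (Fin n → ℝ) × (multiIndices n k → Fin m → ℝ) → ℝ,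
    ContDiffOn ℝ ∞ g {q | (q.1, q.2 ⟨0, zero_mem_multiIndices n k⟩) ∈ O} ∧
    ∀ p ∈ jetsOver O, f p = g (p.1, fun α => p.2 α.1)

/-- `∂f/∂x^σ` at fixed `y^i_α`. -/
def pderivBase (σ : Fin n) (f : Jet n m → ℝ) : Jet n m → ℝ := fun p =>
  deriv (fun t => f (Function.update p.1 σ t, p.2)) (p.1 σ)

/-- `∂f/∂y^i_α`. -/
def pderivJet (α : Fin n → ℕ) (i : Fin m) (f : Jet n m → ℝ) : Jet n m → ℝ := fun p =>
  deriv (fun t => f (p.1, Function.update p.2 α (Function.update (p.2 α) i t))) (p.2 α i)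

/-- The formal (total) derivative `D_σ f = ∂_σ f + ∑_{α,i} y^i_{α+σ} ∂f/∂y^i_α`. -/
def totalDeriv (σ : Fin n) (f : Jet n m → ℝ) : Jet n m → ℝ := fun p =>
  pderivBase σ f p +
    ∑ᶠ a : (Fin n → ℕ) × Fin m, p.2 (a.1 + Pi.single σ 1) a.2 * pderivJet a.1 a.2 f p

/-- The iterated formal derivative `D_α`. -/
def totalDerivs (α : Fin n → ℕ) (f : Jet n m → ℝ) : Jet n m → ℝ := iter totalDeriv α f

/-- The components `E_i = ∑_α (-1)^{|α|} D_α a_i^α` of the source form `E_a`, obtained by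
integration by parts from the contact form `a = a_i^α ϑ^i_α ∧ dx^1 ∧ ⋯ ∧ dx^n`. -/
def sourceForm (a : (Fin n → ℕ) → Fin m → Jet n m → ℝ) (i : Fin m) : Jet n m → ℝ := fun p =>
  ∑ᶠ α : Fin n → ℕ, (-1 : ℝ) ^ degree α * totalDerivs α (a α i) p

/-- The Euler–Lagrange components `E_i(L) = ∑_α (-1)^{|α|} D_α (∂L/∂y^i_α)`: the source form of
the vertical differential of the Lagrangian `L dx^1 ∧ ⋯ ∧ dx^n`. -/
def eulerLagrange (L : Jet n m → ℝ) : Fin m → Jet n m → ℝ :=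
  sourceForm fun α i => pderivJet α i L

/-- The Lie derivative of `f` along the prolongation `D_α Q^i ∂/∂y^i_α` of the vertical
(generalized) vector field `Q^i ∂/∂y^i`. -/
def prolong (Q : Fin m → Jet n m → ℝ) (f : Jet n m → ℝ) : Jet n m → ℝ := fun p =>
  ∑ᶠ a : (Fin n → ℕ) × Fin m, totalDerivs a.1 (Q a.2) p * pderivJet a.1 a.2 f p

/-- The contraction `Q ⌋ E = Q^i E_i` of a vertical field with a source form. -/
def contract (Q E : Fin m → Jet n m → ℝ) : Jet n m → ℝ := fun p => ∑ i, Q i p * E i p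

/-- The second vertical differential of `L`, contracted once with the prolongation of `Q`:
the coefficients of `ϑ^i_α` are `(∂²L/∂y^i_α ∂y^j_β) D_β Q^j`. -/
def hessianForm (Q : Fin m → Jet n m → ℝ) (L : Jet n m → ℝ) (α : Fin n → ℕ) (i : Fin m) :
    Jet n m → ℝ := fun p =>
  ∑ᶠ b : (Fin n → ℕ) × Fin m, pderivJet α i (pderivJet b.1 b.2 L) p * totalDerivs b.1 (Q b.2) p

/-- The second variation `(∂²L/∂y^i_α ∂y^j_β) D_β Q^j D_α w^i` of `L` along two vertical
variations. -/
def hessian (Q w : Fin m → Jet n m → ℝ) (L : Jet n m → ℝ) : Jet n m → ℝ := fun p =>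
  ∑ᶠ a : (Fin n → ℕ) × Fin m, hessianForm Q L a.1 a.2 p * totalDerivs a.1 (w a.2) p

/-- The form `f dx^1 ∧ ⋯ ∧ dx^n` is, locally over `O`, a horizontal differential
`d_H μ = D_σ μ^σ dx^1 ∧ ⋯ ∧ dx^n`; that is, its class modulo local divergences is zero. -/
def IsLocalDivergence (O : Set ((Fin n → ℝ) × (Fin m → ℝ))) (f : Jet n m → ℝ) : Prop :=
  ∀ z ∈ O, ∃ V : Set ((Fin n → ℝ) × (Fin m → ℝ)), IsOpen V ∧ z ∈ V ∧ V ⊆ O ∧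
    ∃ (k : ℕ) (μ : Fin n → Jet n m → ℝ), (∀ σ, IsJetSmooth k V (μ σ)) ∧
      ∀ p ∈ jetsOver V, f p = ∑ σ, totalDeriv σ (μ σ) p

/-- The jet at `u` of a map `f` from the `x`-space to the `y`-space. -/
def jetOf (f : (Fin n → ℝ) → Fin m → ℝ) (u : Fin n → ℝ) : Jet n m :=
  (u, fun α i => iter
    (fun (σ : Fin n) (g : (Fin n → ℝ) → ℝ) v => deriv (fun t => g (Function.update v σ t)) (v σ))
    α (fun v => f v i) u)

end Coordinates

/-! ## Principal bundles, associated bundles, lifts of right-invariant vector fields -/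

section Bundles

variable {n m : ℕ}
  {EH EW : Type*} [NormedAddCommGroup EH] [NormedSpace ℝ EH]
  [NormedAddCommGroup EW] [NormedSpace ℝ EW]
  {X H W F Y : Type*}
  [TopologicalSpace X] [ChartedSpace (Fin n → ℝ) X]
  [TopologicalSpace H] [ChartedSpace EH H] [Group H]
  [TopologicalSpace W] [ChartedSpace EW W] [IsManifold 𝓘(ℝ, EW) ∞ W]
  [TopologicalSpace F] [ChartedSpace (Fin m → ℝ) F] [MulAction H F]
  [TopologicalSpace Y] [ChartedSpace ((Fin n → ℝ) × (Fin m → ℝ)) Y]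

variable (n EH EW X H W) in
/-- A smooth principal bundle `W → X` with structure group `H` (acting on the right). -/
structure PrincipalBundle where
  proj : W → X
  act : W → H → W
  act_one : ∀ w, act w 1 = w
  act_mul : ∀ w h h', act w (h * h') = act (act w h) h'
  proj_act : ∀ w h, proj (act w h) = proj w
  free : ∀ w h, act w h = w → h = 1
  smooth_proj : ContMDiff 𝓘(ℝ, EW) 𝓘(ℝ, Fin n → ℝ) ∞ proj
  smooth_act : ContMDiff (𝓘(ℝ, EW).prod 𝓘(ℝ, EH)) 𝓘(ℝ, EW) ∞ fun q : W × H => act q.1 q.2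
  /-- Local triviality: near every point there are a smooth section `s` and a smooth map `τ`
  with `w = s (proj w) · τ w`. -/
  locallyTrivial : ∀ x : X, ∃ (U : Set X) (s : X → W) (τ : W → H), IsOpen U ∧ x ∈ U ∧
    ContMDiffOn 𝓘(ℝ, Fin n → ℝ) 𝓘(ℝ, EW) ∞ s U ∧
    ContMDiffOn 𝓘(ℝ, EW) 𝓘(ℝ, EH) ∞ τ (proj ⁻¹' U) ∧
    (∀ x' ∈ U, proj (s x') = x') ∧ ∀ w ∈ proj ⁻¹' U, act (s (proj w)) (τ w) = w

variable (m F Y) in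
/-- The bundle `Y = W ×_H F` over `X` associated with the principal bundle `W` by means of the
left action of `H` on `F`: the quotient of `W × F` by `(w · h, f) ∼ (w, h · f)`, with its
quotient smooth structure (a smooth section `s` of `W` over `U` gives the local trivialization
`(x, f) ↦ [s x, f]`, with fibre component `φ` of the inverse). -/
structure AssociatedBundle (B : PrincipalBundle n EH EW X H W) where
  proj : Y → X
  /-- The class `[w, f]`. -/
  cls : W → F → Y
  smooth_proj : ContMDiff 𝓘(ℝ, (Fin n → ℝ) × (Fin m → ℝ)) 𝓘(ℝ, Fin n → ℝ) ∞ proj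
  smooth_cls : ContMDiff (𝓘(ℝ, EW).prod 𝓘(ℝ, Fin m → ℝ)) 𝓘(ℝ, (Fin n → ℝ) × (Fin m → ℝ)) ∞
    fun q : W × F => cls q.1 q.2
  proj_cls : ∀ w f, proj (cls w f) = B.proj w
  cls_surjective : ∀ y, ∃ w f, cls w f = y
  cls_eq_iff : ∀ w f w' f', cls w f = cls w' f' ↔ ∃ h : H, w' = B.act w h ∧ f = h • f'
  trivialization : ∀ (U : Set X) (s : X → W), IsOpen U →
    ContMDiffOn 𝓘(ℝ, Fin n → ℝ) 𝓘(ℝ, EW) ∞ s U → (∀ x ∈ U, B.proj (s x) = x) →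
    ∃ φ : Y → F,
      ContMDiffOn 𝓘(ℝ, (Fin n → ℝ) × (Fin m → ℝ)) 𝓘(ℝ, Fin m → ℝ) ∞ φ (proj ⁻¹' U) ∧
      ∀ y ∈ proj ⁻¹' U, cls (s (proj y)) (φ y) = y

/-- A (local) infinitesimal principal automorphism: a right-invariant smooth vector field on
the part of `W` over an open subset `dom` of `X`, i.e. a local section of `TW/H → X`. -/
structure RightInvariantField (B : PrincipalBundle n EH EW X H W) where
  dom : Set X
  isOpen_dom : IsOpen dom
  toFun : ∀ w : W, TangentSpace 𝓘(ℝ, EW) w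
  smooth : ContMDiffOn 𝓘(ℝ, EW) 𝓘(ℝ, EW).tangent ∞
    (fun w => (⟨w, toFun w⟩ : TangentBundle 𝓘(ℝ, EW) W)) (B.proj ⁻¹' dom)
  invariant : ∀ w ∈ B.proj ⁻¹' dom, ∀ h : H,
    mfderiv 𝓘(ℝ, EW) 𝓘(ℝ, EW) (fun w' => B.act w' h) w (toFun w) = toFun (B.act w h)

variable {B : PrincipalBundle n EH EW X H W}

/-- The lift `Ξ̂ = 𝔊(Ξ)` to the associated bundle: `Ξ̂ [w, f]` is the tangent vector at `t = 0`
of `[Φ_t w, f]`, where `Φ_t` is the flow of `Ξ`, i.e. the image of `Ξ w` under the differential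
of `w ↦ [w, f]`. By right invariance it does not depend on the representative `(w, f)`. -/
def lift (A : AssociatedBundle m F Y B) (Ξ : RightInvariantField B) (y : Y) :
    TangentSpace 𝓘(ℝ, (Fin n → ℝ) × (Fin m → ℝ)) y :=
  let w := (A.cls_surjective y).choose
  let f := (A.cls_surjective y).choose_spec.choose
  mfderiv 𝓘(ℝ, EW) 𝓘(ℝ, (Fin n → ℝ) × (Fin m → ℝ)) (fun w' => A.cls w' f) w (Ξ.toFun w)

/-- A chart `(x^σ, y^i)` of `Y` adapted to the projection `Y → X`. -/
structure FiberedChart (A : AssociatedBundle m F Y B) where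
  base : OpenPartialHomeomorph X (Fin n → ℝ)
  total : OpenPartialHomeomorph Y ((Fin n → ℝ) × (Fin m → ℝ))
  base_mem : base ∈ IsManifold.maximalAtlas 𝓘(ℝ, Fin n → ℝ) ∞ X
  total_mem : total ∈ IsManifold.maximalAtlas 𝓘(ℝ, (Fin n → ℝ) × (Fin m → ℝ)) ∞ Y
  proj_mem : ∀ y ∈ total.source, A.proj y ∈ base.source
  fst_eq : ∀ y ∈ total.source, (total y).1 = base (A.proj y)

variable {A : AssociatedBundle m F Y B}

/-- The coordinate expression of a section of `Y → X`. -/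
def FiberedChart.localRep (e : FiberedChart A) (γ : X → Y) (u : Fin n → ℝ) : Fin m → ℝ :=
  (e.total (γ (e.base.symm u))).2

/-- `γ` is a smooth section of `Y → X` near `x`. -/
def IsSectionNear (A : AssociatedBundle m F Y B) (γ : X → Y) (x : X) : Prop :=
  (∀ᶠ x' in 𝓝 x, A.proj (γ x') = x') ∧
    ContMDiffAt 𝓘(ℝ, Fin n → ℝ) 𝓘(ℝ, (Fin n → ℝ) × (Fin m → ℝ)) ∞ γ x

/-- A Lagrangian of order `s` on `Y`: a smooth horizontal `n`-form `λ` on the jet space of order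
`s`. It is given by its coordinate expressions `λ = L dx^1 ∧ ⋯ ∧ dx^n` in all fibered charts,
subject to the transformation law of `n`-forms at the jets of local sections. -/
structure Lagrangian (A : AssociatedBundle m F Y B) (s : ℕ) where
  coord : FiberedChart A → Jet n m → ℝ
  smooth : ∀ e, IsJetSmooth s e.total.target (coord e)
  compatible : ∀ (e e' : FiberedChart A) (γ : X → Y) (x : X), IsSectionNear A γ x →
    γ x ∈ e.total.source → γ x ∈ e'.total.source →
    coord e (jetOf (e.localRep γ) (e.base x)) =
      coord e' (jetOf (e'.localRep γ) (e'.base x)) *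
        (fderiv ℝ (fun u => e'.base (e.base.symm u)) (e.base x)).det

/-- The part of the image of a fibered chart over the domain of a right-invariant field. -/
def FiberedChart.region (e : FiberedChart A) (Ξ : RightInvariantField B) :
    Set ((Fin n → ℝ) × (Fin m → ℝ)) :=
  {z | z ∈ e.total.target ∧ A.proj (e.total.symm z) ∈ Ξ.dom}

/-- The components `(ξ^σ, Ξ̂^i)` of the lift in a fibered chart:
`Ξ̂ = ξ^σ ∂/∂x^σ + Ξ̂^i ∂/∂y^i`. -/
def FiberedChart.components (e : FiberedChart A) (Ξ : RightInvariantField B)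
    (z : (Fin n → ℝ) × (Fin m → ℝ)) : (Fin n → ℝ) × (Fin m → ℝ) :=
  mfderiv 𝓘(ℝ, (Fin n → ℝ) × (Fin m → ℝ)) 𝓘(ℝ, (Fin n → ℝ) × (Fin m → ℝ)) e.total
    (e.total.symm z) (lift A Ξ (e.total.symm z))

/-- The components `ξ^σ` of the projection of `Ξ` to `X`. -/
def FiberedChart.horizontal (e : FiberedChart A) (Ξ : RightInvariantField B) (σ : Fin n) :
    Jet n m → ℝ := fun p => (e.components Ξ (p.1, p.2 0)).1 σ

/-- The components `Ξ_V^i = Ξ̂^i - y^i_σ ξ^σ` of the vertical part `𝔊(Ξ)_V` of the lift. -/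
def FiberedChart.vertical (e : FiberedChart A) (Ξ : RightInvariantField B) (i : Fin m) :
    Jet n m → ℝ := fun p =>
  (e.components Ξ (p.1, p.2 0)).2 i - ∑ σ, p.2 (Pi.single σ 1) i * e.horizontal Ξ σ p

/-- A quantity with coordinate expression `f e` vanishes identically over the domain of `Ξ`:
in every fibered chart and at every jet. -/
def VanishesOver (Ξ : RightInvariantField B) (f : FiberedChart A → Jet n m → ℝ) : Prop :=
  ∀ e : FiberedChart A, ∀ p ∈ jetsOver (e.region Ξ), f e p = 0

namespace Lagrangian

variable {s : ℕ} (lam : Lagrangian A s) (Ξ : RightInvariantField B)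

/-- The Lie derivative of `λ` along the prolongation of `𝔊(Ξ)`, which splits into the horizontal
part `ξ^σ D_σ` and the vertical part `D_α Ξ_V^i ∂/∂y^i_α`:
`(ξ^σ D_σ L + D_α Ξ_V^i ∂L/∂y^i_α + L D_σ ξ^σ) dx^1 ∧ ⋯ ∧ dx^n`. -/
def lieDeriv (e : FiberedChart A) : Jet n m → ℝ := fun p =>
  (∑ σ, e.horizontal Ξ σ p * totalDeriv σ (lam.coord e) p) +
    prolong (e.vertical Ξ) (lam.coord e) p +
    lam.coord e p * ∑ σ, totalDeriv σ (e.horizontal Ξ σ) p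

/-- `𝔊(Ξ)` is a symmetry of `λ`. -/
def IsSymmetry : Prop := VanishesOver Ξ fun e => lam.lieDeriv Ξ e

/-- `λ` is invariant with respect to the lifts of all fields of the family `𝒜`. -/
def IsGaugeNaturalInvariant (𝒜 : Set (RightInvariantField B)) : Prop :=
  ∀ Ξ ∈ 𝒜, lam.IsSymmetry Ξ

/-- The Lagrangian `ω(λ, 𝔊(Ξ)_V) = £_Ξ ⌋ E(λ) = - Ξ_V^i E_i(λ)`, where `£_Ξ = - 𝔊(Ξ)_V` is the
Lie derivative of sections. -/
def omega (e : FiberedChart A) : Jet n m → ℝ :=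
  contract (fun i p => -e.vertical Ξ i p) (eulerLagrange (lam.coord e))

/-! ### The variation as an independent argument

Here `λ` is varied along `𝔊(Ξ)_V` seen as a point of the fibre of the bundle of variations, so
that vertical differentials act on `λ` only. The resulting morphisms are linear in `𝔊(Ξ)_V`. -/

/-- The generalized Bianchi morphism: the Euler–Lagrange morphism (with respect to the fields
`y`) of `ω = - v^i E_i(λ)` on the bundle with coordinates `(y, v)`, at `v = 𝔊(Ξ)_V`. -/
def bianchi (i : Fin m) (e : FiberedChart A) : Jet n m → ℝ :=
  sourceForm (fun α k p =>
    ∑ j, -e.vertical Ξ j p * pderivJet α k (eulerLagrange (lam.coord e) j) p) i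

/-- The generalized Jacobi morphism: the source form of the second vertical differential of `λ`
contracted with the prolongation of `𝔊(Ξ)_V`. -/
def jacobi (i : Fin m) (e : FiberedChart A) : Jet n m → ℝ :=
  sourceForm (hessianForm (e.vertical Ξ) (lam.coord e)) i

/-- The second variation of `λ` along `𝔊(Ξ)_V` and an arbitrary vertical variation
`w = w^i(x, y) ∂/∂y^i` is zero modulo local divergences. -/
def SecondVariationVanishes : Prop :=
  ∀ (e : FiberedChart A) (w : Fin m → Jet n m → ℝ), (∀ i, IsJetSmooth 0 (e.region Ξ) (w i)) →
    IsLocalDivergence (e.region Ξ) (hessian (e.vertical Ξ) w (lam.coord e))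

/-- The kernel `𝔎` of the Jacobi morphism. -/
def jacobiKernel : Set (RightInvariantField B) :=
  {Ξ | ∀ i, VanishesOver Ξ (lam.jacobi Ξ i)}

/-! ### The variation substituted as a field

Here `𝔊(Ξ)_V` is inserted, as a function on the first jet space, before vertical differentials
are taken. -/

/-- The Euler–Lagrange morphism of the Lagrangian `ω(λ, 𝔊(Ξ)_V)` on the jets of `Y`. -/
def bianchiAlong (i : Fin m) (e : FiberedChart A) : Jet n m → ℝ :=
  eulerLagrange (lam.omega Ξ e) i

/-- The iterated Lie derivative of `λ` along the prolongation of `𝔊(Ξ)_V`, i.e. the second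
formal variation of `λ` with both variation fields equal to `𝔊(Ξ)_V`. -/
def secondVariationAlong (e : FiberedChart A) : Jet n m → ℝ :=
  prolong (e.vertical Ξ) (prolong (e.vertical Ξ) (lam.coord e))

/-- `𝔊(Ξ)_V ⌋ E(𝔊(Ξ)_V ⌋ E(λ))`. -/
def iteratedContraction (e : FiberedChart A) : Jet n m → ℝ :=
  contract (e.vertical Ξ)
    (eulerLagrange (contract (e.vertical Ξ) (eulerLagrange (lam.coord e))))

/-- `E(𝔊(Ξ)_V ⌋ h(dδλ))`, where `δλ` is the first variation of `λ` along `𝔊(Ξ)_V`;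
`𝔊(Ξ)_V ⌋ h(dδλ)` is the derivative of `δλ` along the prolongation of `𝔊(Ξ)_V`. -/
def jacobiAlong (i : Fin m) (e : FiberedChart A) : Jet n m → ℝ :=
  eulerLagrange (prolong (e.vertical Ξ) (prolong (e.vertical Ξ) (lam.coord e))) i

/-- The kernel of `jacobiAlong`. -/
def jacobiKernelAlong : Set (RightInvariantField B) :=
  {Ξ | ∀ i, VanishesOver Ξ (lam.jacobiAlong Ξ i)}

end Lagrangian

end Bundles

end GaugeNatural

end

open scoped ContDiff Manifold Topology

/-! Everything happens in one fibered chart, over the open part of its image lying above the domain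
of the field. There the smooth jet functions of finite order form a commutative algebra
`smoothJets`, on which partial derivatives, formal derivatives and prolongations act as derivations;
`Represents` translates between this algebra and the coordinate formulas. The geometry supplies only
regularity: the lift is smooth, so $\xi^\sigma$ has jet order 0 and $Q^i$ has jet order at most 1.

Sense (A). Let $\ell_q^*$ be the adjoint linearization of $q$, written `eulerPair`. Since
$\ell_{D_\beta q}^*=(-1)^{|\beta|}\,\ell_q^*\circ D_\beta$, the signs in
$E_j(L)=\sum(-1)^{|\beta|}D_\beta\partial_j^\beta L$ cancel, and $\sum_j\ell_{E_j(L)}^*(Q^j)$ is the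
source form of the contracted Hessian (`sum_eulerPair_euler`); this reads $\beta_i=-\mathcal J_i$.
Integration by parts turns the second variation into $\mathcal J_iw^i$ modulo divergences, so it
vanishes if $\mathcal J$ does. The converse is an algebraic form of the fundamental lemma of the
calculus of variations (`isLocalDivergence_hessian_iff`): at a jet $p$, take $w^i=y^i-T$, with $T$
the polynomial in $x$ having the Taylor coefficients prescribed by $p$. Euler operators kill
divergences, while $E_i(\mathcal J_iw^i)(p)=\mathcal J_i(p)$, because $w^i$ is formally flat at $p$
and $\partial w^i/\partial y^i=1$.

Sense (B). Invariance says $\mathrm{pr}_QL=-D_\sigma(\xi^\sigma L)$, whence $Q^iE_i(L)$ is a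
divergence as well, by the first variation formula (`exists_represents_of_invariant`). As
$\mathrm{pr}_Q$ commutes with $D_\sigma$, $\mathrm{pr}_Q\mathrm{pr}_QL$ is also a divergence.
Applying Euler operators shows that each listed statement is true, and the equivalences follow. -/

noncomputable section

namespace GaugeNatural

/-! ### The algebra of smooth jet functions of finite order and its partial derivatives -/

section JetRing

variable {n m : ℕ}

/-- The coordinates of order at most `k` of a jet. -/
def truncate (n m k : ℕ) : Jet n m →ₗ[ℝ] (Fin n → ℝ) × (multiIndices n k → Fin m → ℝ) where
  toFun p := (p.1, fun α => p.2 α.1)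
  map_add' _ _ := rfl
  map_smul' _ _ := rfl

/-- The jets of order `k` lying over a set of the `(x, y)`-space. -/
def truncatedOver (k : ℕ) (O : Set ((Fin n → ℝ) × (Fin m → ℝ))) :
    Set ((Fin n → ℝ) × (multiIndices n k → Fin m → ℝ)) :=
  {q | (q.1, q.2 ⟨0, zero_mem_multiIndices n k⟩) ∈ O}

theorem isOpen_truncatedOver {k : ℕ} {O : Set ((Fin n → ℝ) × (Fin m → ℝ))} (hO : IsOpen O) :
    IsOpen (truncatedOver k O) :=
  hO.preimage (by fun_prop)

theorem multiIndices_mono {k l : ℕ} (h : k ≤ l) : multiIndices n k ⊆ multiIndices n l := by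
  intro α hα
  simp only [multiIndices, Finset.mem_filter, Fintype.mem_piFinset, Finset.mem_range] at hα ⊢
  exact ⟨fun σ => (hα.1 σ).trans_le (by omega), hα.2.trans h⟩

theorem mem_multiIndices {k : ℕ} {α : Fin n → ℕ} : α ∈ multiIndices n k ↔ degree α ≤ k := by
  simp only [multiIndices, Finset.mem_filter, Fintype.mem_piFinset, Finset.mem_range,
    and_iff_right_iff_imp]
  intro h σ
  have : α σ ≤ degree α := Finset.single_le_sum (fun _ _ => Nat.zero_le _) (Finset.mem_univ σ)
  omega

theorem IsJetSmooth.mono_order {k l : ℕ} (h : k ≤ l) {O : Set ((Fin n → ℝ) × (Fin m → ℝ))}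
    {f : Jet n m → ℝ} (hf : IsJetSmooth k O f) : IsJetSmooth l O f := by
  obtain ⟨g, hg, hfg⟩ := hf
  refine ⟨fun q => g (q.1, fun α => q.2 ⟨α.1, multiIndices_mono h α.2⟩), ?_, hfg⟩
  refine hg.comp (t := truncatedOver k O)
    (f := fun q : (Fin n → ℝ) × (multiIndices n l → Fin m → ℝ) =>
      (q.1, fun α : multiIndices n k => q.2 ⟨α.1, multiIndices_mono h α.2⟩)) ?_ fun q hq => hq
  exact ContDiff.contDiffOn (by fun_prop)

theorem IsJetSmooth.mono {k : ℕ} {O V : Set ((Fin n → ℝ) × (Fin m → ℝ))} (h : V ⊆ O)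
    {f : Jet n m → ℝ} (hf : IsJetSmooth k O f) : IsJetSmooth k V f := by
  obtain ⟨g, hg, hfg⟩ := hf
  exact ⟨g, hg.mono fun q hq => h hq, fun p hp => hfg p (h hp)⟩

variable (O : TopologicalSpace.Opens ((Fin n → ℝ) × (Fin m → ℝ)))

/-- The algebra of smooth functions of finite order on the jets over `O`. -/
def smoothJets : Subalgebra ℝ (jetsOver (O : Set ((Fin n → ℝ) × (Fin m → ℝ))) → ℝ) where
  carrier := {f | ∃ (k : ℕ) (F : Jet n m → ℝ), IsJetSmooth k O F ∧ ∀ p, f p = F p.1}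
  mul_mem' := by
    rintro f₁ f₂ ⟨k, F₁, h₁, e₁⟩ ⟨l, F₂, h₂, e₂⟩
    obtain ⟨g₁, hg₁, hfg₁⟩ := h₁.mono_order (le_max_left k l)
    obtain ⟨g₂, hg₂, hfg₂⟩ := h₂.mono_order (le_max_right k l)
    exact ⟨max k l, F₁ * F₂, ⟨g₁ * g₂, hg₁.mul hg₂, fun p hp => by simp [hfg₁ p hp, hfg₂ p hp]⟩,
      fun p => by simp [e₁, e₂]⟩
  add_mem' := by
    rintro f₁ f₂ ⟨k, F₁, h₁, e₁⟩ ⟨l, F₂, h₂, e₂⟩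
    obtain ⟨g₁, hg₁, hfg₁⟩ := h₁.mono_order (le_max_left k l)
    obtain ⟨g₂, hg₂, hfg₂⟩ := h₂.mono_order (le_max_right k l)
    exact ⟨max k l, F₁ + F₂, ⟨g₁ + g₂, hg₁.add hg₂, fun p hp => by simp [hfg₁ p hp, hfg₂ p hp]⟩,
      fun p => by simp [e₁, e₂]⟩
  algebraMap_mem' r := ⟨0, fun _ => r, ⟨fun _ => r, contDiffOn_const, fun _ _ => rfl⟩, fun _ => rfl⟩

variable {O}

theorem mem_smoothJets {f : jetsOver (O : Set ((Fin n → ℝ) × (Fin m → ℝ))) → ℝ} :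
    f ∈ smoothJets O ↔
      ∃ (k : ℕ) (F : Jet n m → ℝ), IsJetSmooth k O F ∧ ∀ p, f p = F p.1 :=
  Iff.rfl

/-- The function `F` on the jet space and the element `f` of the jet algebra agree over `O`. -/
def Represents (F : Jet n m → ℝ) (f : smoothJets O) : Prop :=
  ∀ p : jetsOver (O : Set ((Fin n → ℝ) × (Fin m → ℝ))), F p = f.1 p

theorem IsJetSmooth.exists_represents {k : ℕ} {F : Jet n m → ℝ} (hF : IsJetSmooth k O F) :
    ∃ f : smoothJets O, Represents F f :=
  ⟨⟨fun p => F p, mem_smoothJets.2 ⟨k, F, hF, fun _ => rfl⟩⟩, fun _ => rfl⟩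

theorem Represents.unique {F : Jet n m → ℝ} {f g : smoothJets O} (hf : Represents F f)
    (hg : Represents F g) : f = g :=
  Subtype.ext (funext fun p => (hf p).symm.trans (hg p))

theorem Represents.exists_isJetSmooth {F : Jet n m → ℝ} {f : smoothJets O}
    (hf : Represents F f) : ∃ k, IsJetSmooth k O F := by
  obtain ⟨k, G, ⟨g, hg, hGg⟩, e⟩ := mem_smoothJets.1 f.2
  exact ⟨k, g, hg, fun p hp => by rw [hf ⟨p, hp⟩, e, hGg p hp]⟩

/-- An extension of an element of the jet algebra to all jets. -/
def extend (f : smoothJets O) : Jet n m → ℝ := (mem_smoothJets.1 f.2).choose_spec.choose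

theorem represents_extend (f : smoothJets O) : Represents (extend f) f := fun p =>
  ((mem_smoothJets.1 f.2).choose_spec.choose_spec.2 p).symm

theorem eventually_add_smul_mem_jetsOver {p : Jet n m}
    (hp : p ∈ jetsOver (O : Set ((Fin n → ℝ) × (Fin m → ℝ)))) (v : Jet n m) :
    ∀ᶠ t : ℝ in 𝓝 0, p + t • v ∈ jetsOver (O : Set ((Fin n → ℝ) × (Fin m → ℝ))) := by
  have hc : Continuous fun t : ℝ => (p.1 + t • v.1, p.2 0 + t • v.2 0) := by fun_prop
  refine hc.continuousAt.eventually_mem (O.isOpen.mem_nhds ?_)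
  simpa [jetsOver] using hp

/-- A jet has in general infinitely many coordinates, so only directional derivatives are used on
the jet space. A function of finite order factors through a finite-dimensional truncation, where its
directional derivatives come from a Fréchet derivative. -/
theorem hasLineDerivAt_truncate {k : ℕ} {F : Jet n m → ℝ}
    {g : (Fin n → ℝ) × (multiIndices n k → Fin m → ℝ) → ℝ}
    (hg : ContDiffOn ℝ ∞ g (truncatedOver k O))
    (hF : ∀ p ∈ jetsOver (O : Set ((Fin n → ℝ) × (Fin m → ℝ))), F p = g (truncate n m k p))
    {p : Jet n m} (hp : p ∈ jetsOver (O : Set ((Fin n → ℝ) × (Fin m → ℝ)))) (v : Jet n m) :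
    HasLineDerivAt ℝ F (fderiv ℝ g (truncate n m k p) (truncate n m k v)) p v := by
  have hd : DifferentiableAt ℝ g (truncate n m k p) :=
    (hg.contDiffAt ((isOpen_truncatedOver O.isOpen).mem_nhds hp)).differentiableAt (by simp)
  have h : HasDerivAt (fun t : ℝ => g (truncate n m k p + t • truncate n m k v)) _ 0 :=
    hd.hasFDerivAt.hasLineDerivAt (truncate n m k v)
  refine HasDerivAt.congr_of_eventuallyEq h ?_
  filter_upwards [eventually_add_smul_mem_jetsOver hp v] with t ht
  rw [hF _ ht, map_add, map_smul]

theorem contDiffOn_fderiv_apply {k : ℕ} {g : (Fin n → ℝ) × (multiIndices n k → Fin m → ℝ) → ℝ}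
    (hg : ContDiffOn ℝ ∞ g (truncatedOver k O)) (v) :
    ContDiffOn ℝ ∞ (fun q => fderiv ℝ g q v) (truncatedOver k O) :=
  (hg.fderiv_of_isOpen (isOpen_truncatedOver O.isOpen) (by simp)).clm_apply contDiffOn_const

theorem isJetSmooth_lineDeriv {k : ℕ} {F : Jet n m → ℝ} (hF : IsJetSmooth k O F) (v : Jet n m) :
    IsJetSmooth k O fun p => lineDeriv ℝ F p v := by
  obtain ⟨g, hg, hFg⟩ := hF
  exact ⟨_, contDiffOn_fderiv_apply hg (truncate n m k v), fun p hp =>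
    (hasLineDerivAt_truncate hg hFg hp v).lineDeriv⟩

/-- As `O` is open, short displacements of `p` stay over `O`, so values elsewhere do not matter.
Hence the arbitrary choice made in `extend` does not affect derivatives. -/
theorem Represents.lineDeriv_congr {F G : Jet n m → ℝ} {f : smoothJets O} (hF : Represents F f)
    (hG : Represents G f) {p : Jet n m} (hp : p ∈ jetsOver (O : Set ((Fin n → ℝ) × (Fin m → ℝ))))
    (v : Jet n m) : lineDeriv ℝ F p v = lineDeriv ℝ G p v := by
  refine Filter.EventuallyEq.deriv_eq ?_
  filter_upwards [eventually_add_smul_mem_jetsOver hp v] with t ht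
  rw [hF ⟨_, ht⟩, hG ⟨_, ht⟩]

theorem Represents.lineDifferentiableAt {F : Jet n m → ℝ} {f : smoothJets O} (hF : Represents F f)
    {p : Jet n m} (hp : p ∈ jetsOver (O : Set ((Fin n → ℝ) × (Fin m → ℝ)))) (v : Jet n m) :
    LineDifferentiableAt ℝ F p v := by
  obtain ⟨k, g, hg, hFg⟩ := hF.exists_isJetSmooth
  exact (hasLineDerivAt_truncate hg hFg hp v).lineDifferentiableAt

theorem Represents.add {F G : Jet n m → ℝ} {f g : smoothJets O} (hF : Represents F f)
    (hG : Represents G g) : Represents (fun p => F p + G p) (f + g) := fun p => by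
  simp [hF p, hG p]

theorem Represents.mul {F G : Jet n m → ℝ} {f g : smoothJets O} (hF : Represents F f)
    (hG : Represents G g) : Represents (fun p => F p * G p) (f * g) := fun p => by
  simp [hF p, hG p]

theorem Represents.neg {F : Jet n m → ℝ} {f : smoothJets O} (hF : Represents F f) :
    Represents (fun p => -F p) (-f) := fun p => by
  simp [hF p]

theorem Represents.const_mul {F : Jet n m → ℝ} {f : smoothJets O} (hF : Represents F f) (c : ℝ) :
    Represents (fun p => c * F p) (c • f) := fun p => by
  simp [hF p]

theorem Represents.sum {ι : Type*} {s : Finset ι} {F : ι → Jet n m → ℝ} {f : ι → smoothJets O}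
    (hF : ∀ a ∈ s, Represents (F a) (f a)) :
    Represents (fun p => ∑ a ∈ s, F a p) (∑ a ∈ s, f a) := fun p => by
  simp only [AddSubmonoidClass.coe_finsetSum, Finset.sum_apply]
  exact Finset.sum_congr rfl fun a ha => hF a ha p

theorem Represents.eq_zero_iff {F : Jet n m → ℝ} {f : smoothJets O} (hF : Represents F f) :
    (∀ p ∈ jetsOver (O : Set ((Fin n → ℝ) × (Fin m → ℝ))), F p = 0) ↔ f = 0 := by
  refine ⟨fun h => Subtype.ext (funext fun p => (hF p).symm.trans (h p p.2)), ?_⟩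
  rintro rfl p hp
  exact hF ⟨p, hp⟩

variable (O) in
/-- The derivative of jet functions in the direction of a constant vector field. -/
def dirDeriv (v : Jet n m) : Derivation ℝ (smoothJets O) (smoothJets O) :=
  Derivation.mk'
    { toFun := fun f => ⟨fun p => lineDeriv ℝ (extend f) p v, by
        obtain ⟨k, hk⟩ := (represents_extend f).exists_isJetSmooth
        exact mem_smoothJets.2 ⟨k, _, isJetSmooth_lineDeriv hk v, fun _ => rfl⟩⟩
      map_add' := fun f g => by
        refine Subtype.ext (funext fun p => ?_)
        have hf := (represents_extend f).lineDifferentiableAt p.2 v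
        have hg := (represents_extend g).lineDifferentiableAt p.2 v
        change lineDeriv ℝ (extend (f + g)) p v = _
        rw [(represents_extend (f + g)).lineDeriv_congr
          ((represents_extend f).add (represents_extend g)) p.2]
        exact deriv_add hf hg
      map_smul' := fun c f => by
        refine Subtype.ext (funext fun p => ?_)
        have hf := (represents_extend f).lineDifferentiableAt p.2 v
        change lineDeriv ℝ (extend (c • f)) p v = _
        rw [(represents_extend (c • f)).lineDeriv_congr ((represents_extend f).const_mul c) p.2]
        exact deriv_const_mul c hf }
    fun f g => by
      refine Subtype.ext (funext fun p => ?_)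
      have hf := (represents_extend f).lineDifferentiableAt p.2 v
      have hg := (represents_extend g).lineDifferentiableAt p.2 v
      change lineDeriv ℝ (extend (f * g)) p v = f.1 p * lineDeriv ℝ (extend g) p v +
        g.1 p * lineDeriv ℝ (extend f) p v
      rw [(represents_extend (f * g)).lineDeriv_congr
        ((represents_extend f).mul (represents_extend g)) p.2]
      refine (deriv_mul hf hg).trans ?_
      rw [zero_smul, add_zero, represents_extend f p, represents_extend g p, lineDeriv, lineDeriv]
      ring

theorem Represents.lineDeriv {F : Jet n m → ℝ} {f : smoothJets O} (hF : Represents F f)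
    (v : Jet n m) : Represents (fun p => lineDeriv ℝ F p v) (dirDeriv O v f) := fun p =>
  hF.lineDeriv_congr (represents_extend f) p.2 v

/-- Both orders evaluate the second Fréchet derivative of the same finite-dimensional
representative, which is symmetric. -/
theorem dirDeriv_comm (v w : Jet n m) (f : smoothJets O) :
    dirDeriv O v (dirDeriv O w f) = dirDeriv O w (dirDeriv O v f) := by
  obtain ⟨k, g, hg, hFg⟩ := (represents_extend f).exists_isJetSmooth
  have key : ∀ v w, ∀ p : jetsOver (O : Set ((Fin n → ℝ) × (Fin m → ℝ))),
      (dirDeriv O v (dirDeriv O w f)).1 p =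
        fderiv ℝ (fderiv ℝ g) (truncate n m k p) (truncate n m k v) (truncate n m k w) := by
    intro v w p
    refine (((represents_extend f).lineDeriv w).lineDeriv v p).symm.trans ?_
    beta_reduce
    rw [(hasLineDerivAt_truncate (contDiffOn_fderiv_apply hg (truncate n m k w))
        (fun p hp => (hasLineDerivAt_truncate hg hFg hp w).lineDeriv) p.2 v).lineDeriv]
    have hd : DifferentiableAt ℝ (fderiv ℝ g) (truncate n m k p) :=
      ((hg.fderiv_of_isOpen (m := 1) (isOpen_truncatedOver O.isOpen) (by norm_cast)).contDiffAt
        ((isOpen_truncatedOver O.isOpen).mem_nhds p.2)).differentiableAt (by simp)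
    rw [fderiv_clm_apply hd (differentiableAt_const _)]
    simp
  refine Subtype.ext (funext fun p => ?_)
  rw [key, key]
  refine ((hg.contDiffAt ((isOpen_truncatedOver O.isOpen).mem_nhds
    p.2)).isSymmSndFDerivAt ?_) _ _
  rw [minSmoothness_of_isRCLikeNormedField]
  exact WithTop.coe_le_coe.2 (le_top : (2 : ℕ∞) ≤ ⊤)

/-- The coordinates of the jet space. -/
abbrev Coord (n m : ℕ) : Type := Fin n ⊕ ((Fin n → ℕ) × Fin m)

/-- The coordinate directions of the jet space. -/
def coordVec : Coord n m → Jet n m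
  | .inl σ => (Pi.single σ 1, 0)
  | .inr a => (0, Pi.single a.1 (Pi.single a.2 1))

variable (O) in
/-- The partial derivatives of jet functions. -/
def partialDeriv (c : Coord n m) : Derivation ℝ (smoothJets O) (smoothJets O) :=
  dirDeriv O (coordVec c)

theorem partialDeriv_comm (c d : Coord n m) (f : smoothJets O) :
    partialDeriv O c (partialDeriv O d f) = partialDeriv O d (partialDeriv O c f) :=
  dirDeriv_comm _ _ f

theorem Represents.pderivBase {F : Jet n m → ℝ} {f : smoothJets O} (hF : Represents F f)
    (σ : Fin n) : Represents (pderivBase σ F) (partialDeriv O (.inl σ) f) := fun p => by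
  refine Eq.trans ?_ (hF.lineDeriv (coordVec (.inl σ)) p)
  -- The coordinate derivative is taken at the current value of the coordinate, the line derivative
  -- at parameter 0; a translation of the parameter matches them.
  have h := deriv_comp_const_add (fun t => F (Function.update p.1.1 σ t, p.1.2)) (p.1.1 σ) 0
  rw [add_zero] at h
  refine h.symm.trans (congrArg (fun u : ℝ → ℝ => deriv u 0) (funext fun t => ?_))
  congr 1
  refine Prod.ext (funext fun τ => ?_) (by simp [coordVec])
  by_cases hτ : τ = σ
  · subst hτ; simp [coordVec]
  · simp [coordVec, hτ]

theorem Represents.pderivJet {F : Jet n m → ℝ} {f : smoothJets O} (hF : Represents F f)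
    (α : Fin n → ℕ) (i : Fin m) :
    Represents (pderivJet α i F) (partialDeriv O (.inr (α, i)) f) := fun p => by
  refine Eq.trans ?_ (hF.lineDeriv (coordVec (.inr (α, i))) p)
  have h := deriv_comp_const_add
    (fun t => F (p.1.1, Function.update p.1.2 α (Function.update (p.1.2 α) i t))) (p.1.2 α i) 0
  rw [add_zero] at h
  refine h.symm.trans (congrArg (fun u : ℝ → ℝ => deriv u 0) (funext fun t => ?_))
  congr 1
  refine Prod.ext (by simp [coordVec]) (funext fun β => funext fun j => ?_)
  by_cases hβ : β = α
  · subst hβ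
    by_cases hj : j = i
    · subst hj; simp [coordVec]
    · simp [coordVec, hj]
  · simp [coordVec, hβ]

theorem IsJetSmooth.partialDeriv_eq_zero {k : ℕ} {F : Jet n m → ℝ} (hF : IsJetSmooth k O F)
    {f : smoothJets O} (hf : Represents F f) {α : Fin n → ℕ} (hα : α ∉ multiIndices n k)
    (i : Fin m) : partialDeriv O (.inr (α, i)) f = 0 := by
  obtain ⟨g, hg, hFg⟩ := hF
  refine ((hf.lineDeriv (coordVec (.inr (α, i)))).eq_zero_iff).1 fun p hp => ?_
  rw [(hasLineDerivAt_truncate hg hFg hp _).lineDeriv]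
  have : truncate n m k (coordVec (.inr (α, i))) = 0 := by
    refine Prod.ext rfl (funext fun β => ?_)
    have : β.1 ≠ α := fun h => hα (h ▸ β.2)
    simp [truncate, coordVec, this]
  rw [this, map_zero]

/-- Finite order makes the formal sums over all multi-indices genuinely finite; without this
`finsum` could fall back to its default value 0. -/
theorem exists_partialDeriv_eq_zero (f : smoothJets O) :
    ∃ S : Finset (Fin n → ℕ), ∀ α ∉ S, ∀ i, partialDeriv O (.inr (α, i)) f = 0 := by
  obtain ⟨k, hk⟩ := (represents_extend f).exists_isJetSmooth
  exact ⟨multiIndices n k, fun α hα i => hk.partialDeriv_eq_zero (represents_extend f) hα i⟩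

theorem finite_support_partialDeriv (f : smoothJets O) :
    (Function.support fun c => partialDeriv O c f).Finite := by
  obtain ⟨S, hS⟩ := exists_partialDeriv_eq_zero f
  refine ((Finset.univ : Finset (Fin n)).disjSum (S ×ˢ Finset.univ)).finite_toSet.subset ?_
  rintro (σ | ⟨α, i⟩) h
  · simp
  · have : α ∈ S := by
      by_contra hα
      exact h (hS α hα i)
    simp [this]

variable (O) in
/-- The coordinate functions. -/
def coordFn : Coord n m → smoothJets O
  | .inl σ => ⟨fun p => p.1.1 σ, mem_smoothJets.2 ⟨0, fun p => p.1 σ,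
      ⟨fun q => q.1 σ, ContDiff.contDiffOn (by fun_prop), fun _ _ => rfl⟩, fun _ => rfl⟩⟩
  | .inr a => ⟨fun p => p.1.2 a.1 a.2, mem_smoothJets.2 ⟨degree a.1, fun p => p.2 a.1 a.2,
      ⟨fun q => q.2 ⟨a.1, mem_multiIndices.2 le_rfl⟩ a.2, ContDiff.contDiffOn (by fun_prop),
        fun _ _ => rfl⟩, fun _ => rfl⟩⟩

theorem represents_coordFn_inl (σ : Fin n) :
    Represents (fun p : Jet n m => p.1 σ) (coordFn O (.inl σ)) := fun _ => rfl

theorem represents_coordFn_inr (a : (Fin n → ℕ) × Fin m) :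
    Represents (fun p : Jet n m => p.2 a.1 a.2) (coordFn O (.inr a)) := fun _ => rfl

open Classical in
theorem partialDeriv_coordFn (c d : Coord n m) :
    partialDeriv O c (coordFn O d) = if d = c then 1 else 0 := by
  refine Subtype.ext (funext fun p => ?_)
  have hlin : ∀ a b : ℝ, lineDeriv ℝ (fun t : ℝ => t) a b = b := fun a b => by
    simp [lineDeriv]
  rcases d with σ | a
  · refine (((represents_coordFn_inl σ).lineDeriv (coordVec c)) p).symm.trans ?_
    refine (hlin (p.1.1 σ) ((coordVec c).1 σ)).trans ?_
    rcases c with τ | b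
    · by_cases h : σ = τ
      · subst h; simp [coordVec]
      · simp [coordVec, h]
    · simp [coordVec]
  · refine (((represents_coordFn_inr a).lineDeriv (coordVec c)) p).symm.trans ?_
    refine (hlin (p.1.2 a.1 a.2) ((coordVec c).2 a.1 a.2)).trans ?_
    obtain ⟨α, i⟩ := a
    rcases c with τ | ⟨β, j⟩
    · simp [coordVec]
    · by_cases h : α = β
      · subst h
        by_cases hj : i = j
        · subst hj; simp [coordVec]
        · simp [coordVec, hj]
      · simp [coordVec, h]

end JetRing

/-! ### Iterating commuting operators along a multi-index -/

section Iteration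

variable {n : ℕ}

theorem degree_zero : degree (0 : Fin n → ℕ) = 0 := by simp [degree]

theorem degree_add_single (α : Fin n → ℕ) (σ : Fin n) :
    degree (α + Pi.single σ 1) = degree α + 1 := by
  simp [degree, Finset.sum_add_distrib]

theorem multiIndex_induction {P : (Fin n → ℕ) → Prop} (h0 : P 0)
    (hs : ∀ α σ, P α → P (α + Pi.single σ 1)) (α : Fin n → ℕ) : P α := by
  induction h : degree α generalizing α with
  | zero =>
    have : α = 0 := funext fun σ => by
      simpa using (Finset.sum_eq_zero_iff.1 h) σ (Finset.mem_univ σ)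
    rwa [this]
  | succ N ih =>
    obtain ⟨σ, -, hσ⟩ : ∃ σ ∈ Finset.univ, α σ ≠ 0 :=
      Finset.exists_ne_zero_of_sum_ne_zero (by unfold degree at h; omega)
    -- The truncated subtraction of natural numbers is exact here because `α σ ≠ 0`.
    have hα : (α - Pi.single σ 1) + Pi.single σ 1 = α := funext fun τ => by
      by_cases hτ : τ = σ
      · subst hτ; simp; omega
      · simp [hτ]
    rw [← hα] at h ⊢
    exact hs _ _ (ih _ (by rw [degree_add_single] at h; omega))

/-- One induction for every property inherited from a single step to `iter`: linearity, commutation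
with another operator, and the passage from functions to the jet algebra are all obtained by
choosing `r`. -/
theorem iter_rel {S T : Type*} (r : S → T → Prop) {D : Fin n → S → S} {D' : Fin n → T → T}
    (h : ∀ σ f g, r f g → r (D σ f) (D' σ g)) (α : Fin n → ℕ) {f : S} {g : T} (hfg : r f g) :
    r (iter D α f) (iter D' α g) := by
  unfold iter
  induction List.finRange n with
  | nil => exact hfg
  | cons σ l ih =>
    simp only [List.foldr_cons]
    induction α σ with
    | zero => exact ih
    | succ k ihk =>
      rw [Function.iterate_succ_apply', Function.iterate_succ_apply']
      exact h _ _ _ ihk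

theorem iter_zero {T : Type*} (D : Fin n → T → T) (f : T) : iter D 0 f = f := by
  unfold iter
  induction List.finRange n with
  | nil => rfl
  | cons σ l ih => simp

/-- The factors of `iter` stand in the fixed order of `Fin n`; commutativity moves the additional `D
σ` out past those preceding it. -/
theorem iter_add_single {T : Type*} {D : Fin n → T → T}
    (h : ∀ σ τ, Function.Commute (D σ) (D τ)) (α : Fin n → ℕ) (σ : Fin n) (f : T) :
    iter D (α + Pi.single σ 1) f = D σ (iter D α f) := by
  have key : ∀ l : List (Fin n), l.Nodup →
      l.foldr (fun τ g => (D τ)^[(α + Pi.single σ 1 : Fin n → ℕ) τ] g) f =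
        if σ ∈ l then D σ (l.foldr (fun τ g => (D τ)^[α τ] g) f)
        else l.foldr (fun τ g => (D τ)^[α τ] g) f := by
    intro l
    induction l with
    | nil => simp
    | cons τ l ih =>
      intro hl
      rw [List.nodup_cons] at hl
      rw [List.foldr_cons, List.foldr_cons, ih hl.2]
      by_cases hτ : τ = σ
      · subst hτ
        simp [hl.1, Function.iterate_succ_apply']
      · have hτ' : σ ≠ τ := fun h => hτ h.symm
        by_cases hσ : σ ∈ l
        · simp only [Pi.add_apply, Pi.single_eq_of_ne hτ, add_zero, hσ, if_true,
            List.mem_cons, or_true]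
          exact ((h τ σ).iterate_left (α τ)) _
        · simp [hσ, hτ, hτ']
  exact (key _ (List.nodup_finRange n)).trans (if_pos (List.mem_finRange σ))

end Iteration

/-! ### Vector fields on the jet space: formal derivatives and prolongations -/

section VectorFields

variable {n m : ℕ} {O : TopologicalSpace.Opens ((Fin n → ℝ) × (Fin m → ℝ))}

theorem finite_support_mul_partialDeriv (ξ : Coord n m → smoothJets O) (f : smoothJets O) :
    (Function.support fun c => ξ c * partialDeriv O c f).Finite :=
  (finite_support_partialDeriv f).subset fun _ hc h => hc (by
    beta_reduce at h ⊢; rw [h, mul_zero])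

/-- The vector field on the jet space with components `ξ`. -/
def vectorField (ξ : Coord n m → smoothJets O) : Derivation ℝ (smoothJets O) (smoothJets O) :=
  Derivation.mk'
    { toFun := fun f => ∑ᶠ c, ξ c * partialDeriv O c f
      map_add' := fun f g => by
        simp only [map_add, mul_add]
        exact finsum_add_distrib (finite_support_mul_partialDeriv ξ f)
          (finite_support_mul_partialDeriv ξ g)
      map_smul' := fun r f => by
        simp only [Derivation.map_smul, mul_smul_comm, RingHom.id_apply]
        exact (smul_finsum' r (finite_support_mul_partialDeriv ξ f)).symm }
    fun f g => by
      simp only [LinearMap.coe_mk, AddHom.coe_mk, Derivation.leibniz, mul_add, smul_eq_mul]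
      rw [finsum_add_distrib, mul_finsum' _ _ (finite_support_mul_partialDeriv ξ g),
        mul_finsum' _ _ (finite_support_mul_partialDeriv ξ f)]
      · congr 1 <;> exact finsum_congr fun c => by ring
      · exact (finite_support_mul_partialDeriv (fun c => ξ c * f) g).subset fun c hc => by
          simpa only [Function.mem_support, mul_assoc] using hc
      · exact (finite_support_mul_partialDeriv (fun c => ξ c * g) f).subset fun c hc => by
          simpa only [Function.mem_support, mul_assoc] using hc

theorem vectorField_apply (ξ : Coord n m → smoothJets O) (f : smoothJets O) :
    vectorField ξ f = ∑ᶠ c, ξ c * partialDeriv O c f := rfl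

theorem vectorField_eq_sum (ξ : Coord n m → smoothJets O) {f : smoothJets O}
    {T : Finset (Coord n m)} (hT : ∀ c ∉ T, partialDeriv O c f = 0) :
    vectorField ξ f = ∑ c ∈ T, ξ c * partialDeriv O c f := by
  refine finsum_eq_sum_of_support_subset _ fun c hc => ?_
  by_contra h
  exact hc (by beta_reduce; rw [hT c h, mul_zero])

open Classical in
theorem vectorField_coordFn (ξ : Coord n m → smoothJets O) (c : Coord n m) :
    vectorField ξ (coordFn O c) = ξ c := by
  rw [vectorField_apply, finsum_eq_single _ c]
  · simp [partialDeriv_coordFn]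
  · intro d hd
    simp [partialDeriv_coordFn, hd.symm]

theorem vectorField_congr {ξ η : Coord n m → smoothJets O} (h : ∀ c, ξ c = η c)
    (f : smoothJets O) : vectorField ξ f = vectorField η f := by
  rw [funext h]

theorem vectorField_zero (f : smoothJets O) :
    vectorField (fun _ : Coord n m => (0 : smoothJets O)) f = 0 := by
  simp [vectorField_apply]

open Classical in
theorem vectorField_single (c : Coord n m) (f : smoothJets O) :
    vectorField (Pi.single c 1) f = partialDeriv O c f := by
  rw [vectorField_apply, finsum_eq_single _ c]
  · simp
  · intro d hd
    simp [hd]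

/-- The second-order terms cancel by symmetry of the partial derivatives, so a bracket is again a
vector field. To prove that two fields commute it then suffices to compare their actions on each
other's components. -/
theorem vectorField_commutator (ξ η : Coord n m → smoothJets O) (f : smoothJets O) :
    vectorField ξ (vectorField η f) = vectorField η (vectorField ξ f) +
      vectorField (fun c => vectorField ξ (η c) - vectorField η (ξ c)) f := by
  set T := (finite_support_partialDeriv f).toFinset with hTdef
  have hT : ∀ c ∉ T, partialDeriv O c f = 0 := fun c hc => by simpa [hTdef] using hc
  have hT' : ∀ c, ∀ d ∉ T, partialDeriv O d (partialDeriv O c f) = 0 := fun c d hd => by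
    rw [partialDeriv_comm, hT d hd, map_zero]
  simp only [vectorField_eq_sum _ hT, map_sum, Derivation.leibniz, smul_eq_mul,
    vectorField_eq_sum _ (hT' _), sub_mul, Finset.sum_add_distrib, Finset.sum_sub_distrib,
    Finset.mul_sum]
  have : ∑ c ∈ T, ∑ d ∈ T, η c * (ξ d * partialDeriv O d (partialDeriv O c f)) =
      ∑ c ∈ T, ∑ d ∈ T, ξ c * (η d * partialDeriv O d (partialDeriv O c f)) := by
    rw [Finset.sum_comm]
    refine Finset.sum_congr rfl fun c _ => Finset.sum_congr rfl fun d _ => ?_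
    rw [partialDeriv_comm d c]
    ring
  rw [this]
  simp only [mul_comm (partialDeriv O _ f)]
  ring

variable (O) in
/-- The components of the formal derivative `D_σ`. -/
def totalCoeff (σ : Fin n) : Coord n m → smoothJets O
  | .inl τ => if τ = σ then 1 else 0
  | .inr a => coordFn O (.inr (a.1 + Pi.single σ 1, a.2))

variable (O) in
/-- The formal derivative `D_σ` as a derivation of the jet algebra. -/
def formalDeriv (σ : Fin n) : Derivation ℝ (smoothJets O) (smoothJets O) :=
  vectorField (totalCoeff O σ)

theorem totalCoeff_inr (σ : Fin n) (a : (Fin n → ℕ) × Fin m) :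
    totalCoeff O σ (.inr a) = coordFn O (.inr (a.1 + Pi.single σ 1, a.2)) := rfl

theorem formalDeriv_apply (σ : Fin n) (f : smoothJets O) :
    formalDeriv O σ f = vectorField (totalCoeff O σ) f := rfl

theorem formalDeriv_coordFn_inr (σ : Fin n) (a : (Fin n → ℕ) × Fin m) :
    formalDeriv O σ (coordFn O (.inr a)) = coordFn O (.inr (a.1 + Pi.single σ 1, a.2)) :=
  vectorField_coordFn _ _

theorem formalDeriv_coordFn_inl (σ τ : Fin n) :
    formalDeriv O σ (coordFn O (.inl τ)) = if τ = σ then 1 else 0 :=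
  vectorField_coordFn _ _

theorem map_totalCoeff_inl (X : Derivation ℝ (smoothJets O) (smoothJets O)) (σ τ : Fin n) :
    X (totalCoeff O σ (.inl τ)) = 0 := by
  rw [totalCoeff]
  split_ifs <;> simp

theorem formalDeriv_comm (σ τ : Fin n) (f : smoothJets O) :
    formalDeriv O σ (formalDeriv O τ f) = formalDeriv O τ (formalDeriv O σ f) := by
  unfold formalDeriv
  rw [vectorField_commutator, add_eq_left]
  refine (vectorField_congr ?_ f).trans (vectorField_zero f)
  rintro (ρ | a)
  · rw [map_totalCoeff_inl, map_totalCoeff_inl, sub_zero]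
  · rw [totalCoeff_inr, totalCoeff_inr, vectorField_coordFn, vectorField_coordFn, totalCoeff_inr,
      totalCoeff_inr, sub_eq_zero, add_right_comm]

open Classical in
theorem partialDeriv_formalDeriv (c : Coord n m) (σ : Fin n) (f : smoothJets O) :
    partialDeriv O c (formalDeriv O σ f) = formalDeriv O σ (partialDeriv O c f) +
      vectorField (fun d => partialDeriv O c (totalCoeff O σ d)) f := by
  unfold formalDeriv
  rw [← vectorField_single c, vectorField_commutator, vectorField_single, add_right_inj]
  refine vectorField_congr (fun d => ?_) f
  rw [vectorField_single, sub_eq_self]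
  by_cases h : d = c
  · subst h; simp
  · simp [h]

/-- Among the coefficients $y^j_{\beta+\sigma}$ of $D_\sigma$, only the one multiplying
$\partial_i^\alpha$ involves $y^i_{\alpha+\sigma}$. -/
theorem partialDeriv_formalDeriv_add_single (α : Fin n → ℕ) (i : Fin m) (σ : Fin n)
    (f : smoothJets O) :
    partialDeriv O (.inr (α + Pi.single σ 1, i)) (formalDeriv O σ f) =
      formalDeriv O σ (partialDeriv O (.inr (α + Pi.single σ 1, i)) f) +
        partialDeriv O (.inr (α, i)) f := by
  classical
  rw [partialDeriv_formalDeriv, ← vectorField_single (.inr (α, i)), add_right_inj]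
  refine vectorField_congr ?_ f
  rintro (τ | ⟨β, j⟩)
  · rw [map_totalCoeff_inl]; simp
  · rw [totalCoeff, partialDeriv_coordFn, Pi.single_apply]
    simp

/-- A multi-index without $\sigma$ is never of the form $\beta+\sigma$, so no coefficient of
$D_\sigma$ involves $y^i_\alpha$. -/
theorem partialDeriv_formalDeriv_of_eq_zero {α : Fin n → ℕ} {σ : Fin n} (hα : α σ = 0)
    (i : Fin m) (f : smoothJets O) :
    partialDeriv O (.inr (α, i)) (formalDeriv O σ f) =
      formalDeriv O σ (partialDeriv O (.inr (α, i)) f) := by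
  classical
  rw [partialDeriv_formalDeriv, add_eq_left]
  refine (vectorField_congr ?_ f).trans (vectorField_zero f)
  rintro (τ | ⟨β, j⟩)
  · rw [map_totalCoeff_inl]
  · rw [totalCoeff, partialDeriv_coordFn, if_neg]
    intro h
    simp only [Sum.inr.injEq, Prod.mk.injEq] at h
    have := congrFun h.1 σ
    simp [hα] at this

variable (O) in
/-- The iterated formal derivative `D_α` on the jet algebra. -/
def formalDerivs (α : Fin n → ℕ) : smoothJets O →ₗ[ℝ] smoothJets O where
  toFun := iter (fun σ => formalDeriv O σ) α
  map_add' f g := by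
    -- Additivity through `iter_rel`: the iteration runs on pairs, and the relations select the
    -- first entry, the second entry and their sum.
    have h := fun (r : smoothJets O × smoothJets O → smoothJets O → Prop) hr s hs =>
      iter_rel r (D := fun σ p => (formalDeriv O σ p.1, formalDeriv O σ p.2))
        (D' := fun σ => formalDeriv O σ) hr α (f := (f, g)) (g := s) hs
    have h₁ := h (fun p s => p.1 = s) (fun σ p s e => by rw [← e]) f rfl
    have h₂ := h (fun p s => p.2 = s) (fun σ p s e => by rw [← e]) g rfl
    have h₃ := h (fun p s => p.1 + p.2 = s) (fun σ p s e => by rw [← e, map_add]) (f + g) rfl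
    rw [← h₁, ← h₂, ← h₃]
  map_smul' c f := (iter_rel (fun u v => c • u = v) (D := fun σ => formalDeriv O σ)
    (D' := fun σ => formalDeriv O σ) (fun σ u v e => by rw [← e, Derivation.map_smul]) α
    (f := f) rfl).symm

theorem formalDerivs_zero (f : smoothJets O) : formalDerivs O 0 f = f := iter_zero _ f

theorem formalDerivs_add_single (α : Fin n → ℕ) (σ : Fin n) (f : smoothJets O) :
    formalDerivs O (α + Pi.single σ 1) f = formalDeriv O σ (formalDerivs O α f) :=
  iter_add_single (fun σ τ f => formalDeriv_comm σ τ f) α σ f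

theorem formalDeriv_formalDerivs (σ : Fin n) (α : Fin n → ℕ) (f : smoothJets O) :
    formalDeriv O σ (formalDerivs O α f) = formalDerivs O α (formalDeriv O σ f) :=
  iter_rel (fun u v => formalDeriv O σ u = v) (D := fun τ => formalDeriv O τ)
    (D' := fun τ => formalDeriv O τ) (fun τ u v e => by rw [← e, formalDeriv_comm]) α rfl

/-- The components of the prolongation of a vertical field. -/
def prolongCoeff (Q : Fin m → smoothJets O) : Coord n m → smoothJets O
  | .inl _ => 0
  | .inr a => formalDerivs O a.1 (Q a.2)

theorem prolongCoeff_inl (Q : Fin m → smoothJets O) (σ : Fin n) :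
    prolongCoeff Q (.inl σ) = 0 := rfl

theorem prolongCoeff_inr (Q : Fin m → smoothJets O) (a : (Fin n → ℕ) × Fin m) :
    prolongCoeff Q (.inr a) = formalDerivs O a.1 (Q a.2) := rfl

/-- The derivative along the prolongation of a vertical field. -/
def evolution (Q : Fin m → smoothJets O) : Derivation ℝ (smoothJets O) (smoothJets O) :=
  vectorField (prolongCoeff Q)

/-- This is what dictates the coefficients of a prolongation: on $y^i_\alpha$ both compositions give
$D_{\alpha+\sigma}Q^i$, so all components of the bracket vanish. -/
theorem evolution_formalDeriv (Q : Fin m → smoothJets O) (σ : Fin n) (f : smoothJets O) :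
    evolution Q (formalDeriv O σ f) = formalDeriv O σ (evolution Q f) := by
  unfold evolution formalDeriv
  rw [vectorField_commutator, add_eq_left]
  refine (vectorField_congr ?_ f).trans (vectorField_zero f)
  rintro (τ | a)
  · rw [map_totalCoeff_inl, prolongCoeff_inl, map_zero, sub_zero]
  · rw [totalCoeff_inr, vectorField_coordFn, prolongCoeff_inr, prolongCoeff_inr,
      formalDerivs_add_single, formalDeriv_apply, sub_self]

theorem evolution_eq_sum (Q : Fin m → smoothJets O) {f : smoothJets O}
    {S : Finset (Fin n → ℕ)} (hS : ∀ α ∉ S, ∀ i, partialDeriv O (.inr (α, i)) f = 0) :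
    evolution Q f =
      ∑ α ∈ S, ∑ i, formalDerivs O α (Q i) * partialDeriv O (.inr (α, i)) f := by
  classical
  rw [evolution, vectorField_eq_sum (T := Finset.univ.disjSum (S ×ˢ Finset.univ))]
  · rw [Finset.sum_disjSum, Finset.sum_product]
    simp [prolongCoeff]
  · rintro (σ | ⟨α, i⟩) h
    · simp at h
    · exact hS α (fun hα => h (by simp [hα])) i

end VectorFields

/-! ### Adjoint linearizations, Euler operators and divergences -/

section EulerOperators

variable {n m : ℕ} {O : TopologicalSpace.Opens ((Fin n → ℝ) × (Fin m → ℝ))}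

/-- The adjoint sum `∑_α (-1)^{|α|} D_α a^α`. -/
def adjointSum (a : (Fin n → ℕ) → smoothJets O) : smoothJets O :=
  ∑ᶠ α, (-1 : ℝ) ^ degree α • formalDerivs O α (a α)

theorem adjointSum_eq_sum {a : (Fin n → ℕ) → smoothJets O} {S : Finset (Fin n → ℕ)}
    (hS : ∀ α ∉ S, a α = 0) :
    adjointSum a = ∑ α ∈ S, (-1 : ℝ) ^ degree α • formalDerivs O α (a α) := by
  refine finsum_eq_sum_of_support_subset _ fun α hα => ?_
  by_contra h
  exact hα (by beta_reduce; rw [hS α h, map_zero, smul_zero])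

variable (O) in
/-- The operator `(q, g) ↦ ∑_α (-1)^{|α|} D_α (∂q/∂y^i_α · g)`: the adjoint of the linearization
of `q`, applied to `g`. -/
def eulerPair (i : Fin m) : smoothJets O →ₗ[ℝ] smoothJets O →ₗ[ℝ] smoothJets O :=
  LinearMap.mk₂ ℝ (fun q g => adjointSum fun α => partialDeriv O (.inr (α, i)) q * g)
    (fun q q' g => by
      obtain ⟨S, hS⟩ := exists_partialDeriv_eq_zero q
      obtain ⟨S', hS'⟩ := exists_partialDeriv_eq_zero q'
      classical
      rw [adjointSum_eq_sum (S := S ∪ S'), adjointSum_eq_sum (S := S ∪ S'),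
        adjointSum_eq_sum (S := S ∪ S'), ← Finset.sum_add_distrib]
      · simp only [map_add, add_mul, smul_add]
      all_goals
        intro α hα
        simp only [Finset.mem_union, not_or] at hα
        simp [hS α hα.1, hS' α hα.2])
    (fun c q g => by
      obtain ⟨S, hS⟩ := exists_partialDeriv_eq_zero q
      rw [adjointSum_eq_sum (S := S), adjointSum_eq_sum (S := S), Finset.smul_sum]
      · simp only [Derivation.map_smul, smul_mul_assoc, map_smul]
        exact Finset.sum_congr rfl fun α _ => smul_comm _ _ _
      · intro α hα; simp [hS α hα]
      · intro α hα; rw [Derivation.map_smul]; simp [hS α hα])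
    (fun q g g' => by
      obtain ⟨S, hS⟩ := exists_partialDeriv_eq_zero q
      rw [adjointSum_eq_sum (S := S), adjointSum_eq_sum (S := S), adjointSum_eq_sum (S := S),
        ← Finset.sum_add_distrib]
      · simp only [map_add, mul_add, smul_add]
      all_goals
        intro α hα
        simp [hS α hα])
    (fun c q g => by
      obtain ⟨S, hS⟩ := exists_partialDeriv_eq_zero q
      rw [adjointSum_eq_sum (S := S), adjointSum_eq_sum (S := S), Finset.smul_sum]
      · simp only [mul_smul_comm, map_smul]
        exact Finset.sum_congr rfl fun α _ => smul_comm _ _ _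
      all_goals
        intro α hα
        simp [hS α hα])

theorem eulerPair_apply (i : Fin m) (q g : smoothJets O) :
    eulerPair O i q g = adjointSum fun α => partialDeriv O (.inr (α, i)) q * g := rfl

theorem eulerPair_eq_sum (i : Fin m) {q : smoothJets O} {S : Finset (Fin n → ℕ)}
    (hS : ∀ α ∉ S, ∀ i, partialDeriv O (.inr (α, i)) q = 0) (g : smoothJets O) :
    eulerPair O i q g = ∑ α ∈ S, (-1 : ℝ) ^ degree α •
      formalDerivs O α (partialDeriv O (.inr (α, i)) q * g) :=
  adjointSum_eq_sum fun α hα => by rw [hS α hα, zero_mul]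

/-- The linearization of $D_\sigma q$ is $D_\sigma$ composed with that of $q$; taking adjoints
reverses the order and replaces $D_\sigma$ by $-D_\sigma$. -/
theorem eulerPair_formalDeriv (i : Fin m) (σ : Fin n) (q g : smoothJets O) :
    eulerPair O i (formalDeriv O σ q) g = -eulerPair O i q (formalDeriv O σ g) := by
  classical
  obtain ⟨S, hS⟩ := exists_partialDeriv_eq_zero q
  set e : (Fin n → ℕ) → (Fin n → ℕ) := fun α => α + Pi.single σ 1 with he
  have hinj : Function.Injective e := add_left_injective _
  -- `X α` is the commutator of $\partial_i^\alpha$ with $D_\sigma$ on `q`. It lives on shifted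
  -- multi-indices, where it equals the partial derivative of `q` at the unshifted one.
  set X : (Fin n → ℕ) → smoothJets O := fun α =>
    partialDeriv O (.inr (α, i)) (formalDeriv O σ q) -
      formalDeriv O σ (partialDeriv O (.inr (α, i)) q) with hX
  have hXe : ∀ α, X (e α) = partialDeriv O (.inr (α, i)) q := fun α => by
    rw [hX, he]
    beta_reduce
    rw [partialDeriv_formalDeriv_add_single, add_sub_cancel_left]
  have hXS : ∀ α ∉ S.image e, X α = 0 := by
    intro α hα
    by_cases h0 : α σ = 0
    · rw [hX]
      beta_reduce
      rw [partialDeriv_formalDeriv_of_eq_zero h0, sub_self]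
    · have hα' : e (α - Pi.single σ 1) = α := funext fun τ => by
        by_cases hτ : τ = σ
        · subst hτ; simp [he]; omega
        · simp [he, hτ]
      rw [← hα', hXe]
      exact hS _ (fun h => hα (hα' ▸ Finset.mem_image_of_mem e h)) i
  have h₁ : eulerPair O i (formalDeriv O σ q) g =
      adjointSum (fun α => formalDeriv O σ (partialDeriv O (.inr (α, i)) q) * g) +
        adjointSum (fun α => X α * g) := by
    rw [eulerPair_apply, adjointSum_eq_sum (S := S ∪ S.image e),
      adjointSum_eq_sum (S := S ∪ S.image e), adjointSum_eq_sum (S := S ∪ S.image e),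
      ← Finset.sum_add_distrib]
    · refine Finset.sum_congr rfl fun α _ => ?_
      rw [← smul_add, ← map_add, ← add_mul, hX, add_sub_cancel]
    all_goals
      intro α hα
      simp only [Finset.mem_union, not_or] at hα
    · rw [hXS α hα.2, zero_mul]
    · rw [hS α hα.1, map_zero, zero_mul]
    · have := hXS α hα.2
      rw [hX] at this
      beta_reduce at this
      rw [hS α hα.1, map_zero, sub_zero] at this
      rw [this, zero_mul]
  rw [h₁, adjointSum_eq_sum (S := S), adjointSum_eq_sum (S := S.image e),
    Finset.sum_image hinj.injOn, eulerPair_eq_sum i hS, ← Finset.sum_neg_distrib,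
    ← Finset.sum_add_distrib]
  -- After reindexing, the shifted term has one more $D_\sigma$ and the opposite sign; by Leibniz
  -- only the term with $D_\sigma$ on `g` survives.
  · refine Finset.sum_congr rfl fun α _ => ?_
    rw [hXe, he]
    beta_reduce
    rw [degree_add_single, formalDerivs_add_single, formalDeriv_formalDerivs, pow_succ, mul_neg,
      mul_one, neg_smul, ← smul_neg, ← smul_add, ← smul_neg, ← map_neg (formalDerivs O α),
      ← map_neg (formalDerivs O α), ← map_add, Derivation.leibniz]
    congr 2
    simp only [smul_eq_mul]
    ring
  · intro α hα
    rw [hXS α hα, zero_mul]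
  · intro α hα
    rw [hS α hα, map_zero, zero_mul]

theorem eulerPair_formalDerivs (i : Fin m) (α : Fin n → ℕ) (q g : smoothJets O) :
    eulerPair O i (formalDerivs O α q) g =
      (-1 : ℝ) ^ degree α • eulerPair O i q (formalDerivs O α g) := by
  induction α using multiIndex_induction generalizing g with
  | h0 => simp [degree_zero, formalDerivs_zero]
  | hs α σ ih =>
    rw [formalDerivs_add_single, eulerPair_formalDeriv, ih, ← formalDeriv_formalDerivs,
      formalDerivs_add_single, degree_add_single, pow_succ, mul_neg, mul_one, neg_smul]

variable (O) in
/-- The Euler–Lagrange operator on the jet algebra. -/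
def euler (i : Fin m) (f : smoothJets O) : smoothJets O :=
  adjointSum fun α => partialDeriv O (.inr (α, i)) f

theorem euler_eq_eulerPair (i : Fin m) (f : smoothJets O) :
    euler O i f = eulerPair O i f 1 := by
  simp only [euler, eulerPair_apply, mul_one]

theorem euler_mul (i : Fin m) (q g : smoothJets O) :
    euler O i (q * g) = eulerPair O i q g + eulerPair O i g q := by
  obtain ⟨S, hS⟩ := exists_partialDeriv_eq_zero q
  obtain ⟨S', hS'⟩ := exists_partialDeriv_eq_zero g
  classical
  have hT : ∀ α ∉ S ∪ S', ∀ i, partialDeriv O (.inr (α, i)) q = 0 := fun α hα =>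
    hS α fun h => hα (Finset.mem_union_left _ h)
  have hT' : ∀ α ∉ S ∪ S', ∀ i, partialDeriv O (.inr (α, i)) g = 0 := fun α hα =>
    hS' α fun h => hα (Finset.mem_union_right _ h)
  rw [euler, eulerPair_eq_sum i hT, eulerPair_eq_sum i hT', ← Finset.sum_add_distrib,
    adjointSum_eq_sum (S := S ∪ S')]
  · refine Finset.sum_congr rfl fun α _ => ?_
    rw [← smul_add, ← map_add, Derivation.leibniz]
    congr 2
    simp only [smul_eq_mul]
    ring
  · intro α hα
    rw [Derivation.leibniz, hT α hα, hT' α hα]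
    simp

variable (n m O) in
/-- The formal divergences `D_σ μ^σ`. -/
def divergences : Submodule ℝ (smoothJets O) :=
  LinearMap.range (∑ σ : Fin n, (formalDeriv O σ).toLinearMap ∘ₗ
    (LinearMap.proj σ : (Fin n → smoothJets O) →ₗ[ℝ] smoothJets O))

theorem mem_divergences {f : smoothJets O} :
    f ∈ divergences n m O ↔ ∃ μ : Fin n → smoothJets O, ∑ σ, formalDeriv O σ (μ σ) = f := by
  simp [divergences, LinearMap.mem_range]

theorem formalDeriv_mem_divergences (σ : Fin n) (f : smoothJets O) :
    formalDeriv O σ f ∈ divergences n m O := by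
  classical
  refine mem_divergences.2 ⟨Pi.single σ f, ?_⟩
  rw [Finset.sum_eq_single σ]
  · simp
  · intro τ _ hτ
    simp [hτ]
  · simp

/-- The Euler operator is the adjoint linearization applied to 1. On a divergence $D_\sigma$ is
moved onto this 1, which it annihilates. -/
theorem euler_eq_zero {f : smoothJets O} (hf : f ∈ divergences n m O) (i : Fin m) :
    euler O i f = 0 := by
  obtain ⟨μ, rfl⟩ := mem_divergences.1 hf
  rw [euler_eq_eulerPair, map_sum, LinearMap.sum_apply]
  refine Finset.sum_eq_zero fun σ _ => ?_
  rw [eulerPair_formalDeriv, Derivation.map_one_eq_zero, map_zero, neg_zero]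

/-- Integration by parts. -/
theorem mul_formalDerivs_sub_mem (α : Fin n → ℕ) (a w : smoothJets O) :
    a * formalDerivs O α w - (-1 : ℝ) ^ degree α • formalDerivs O α a * w ∈
      divergences n m O := by
  induction α using multiIndex_induction generalizing a with
  | h0 => simp [degree_zero, formalDerivs_zero]
  | hs α σ ih =>
    -- Subtracting the induction hypothesis for $D_\sigma a$ from the exact term
    -- $D_\sigma(a\,D_\alpha w)$ cancels $D_\sigma a\,D_\alpha w$.
    have h := (divergences n m O).sub_mem
      (formalDeriv_mem_divergences σ (a * formalDerivs O α w)) (ih (formalDeriv O σ a))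
    convert h using 1
    rw [formalDerivs_add_single, formalDerivs_add_single, Derivation.leibniz, degree_add_single,
      pow_succ, formalDeriv_formalDerivs σ α a]
    simp only [smul_eq_mul, mul_neg, mul_one, neg_smul]
    ring

theorem sum_mul_formalDerivs_sub_mem {a : (Fin n → ℕ) → Fin m → smoothJets O}
    {S : Finset (Fin n → ℕ)} (hS : ∀ α ∉ S, ∀ i, a α i = 0) (w : Fin m → smoothJets O) :
    ∑ α ∈ S, ∑ i, a α i * formalDerivs O α (w i) - ∑ i, adjointSum (fun α => a α i) * w i ∈
      divergences n m O := by
  have : ∑ i, adjointSum (fun α => a α i) * w i =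
      ∑ α ∈ S, ∑ i, (-1 : ℝ) ^ degree α • formalDerivs O α (a α i) * w i := by
    rw [Finset.sum_comm]
    refine Finset.sum_congr rfl fun i _ => ?_
    rw [adjointSum_eq_sum fun α hα => hS α hα i, Finset.sum_mul]
  rw [this, ← Finset.sum_sub_distrib]
  refine Submodule.sum_mem _ fun α _ => ?_
  rw [← Finset.sum_sub_distrib]
  exact Submodule.sum_mem _ fun i _ => mul_formalDerivs_sub_mem α _ _

theorem evolution_sub_mem (Q : Fin m → smoothJets O) (L : smoothJets O) :
    evolution Q L - ∑ i, euler O i L * Q i ∈ divergences n m O := by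
  obtain ⟨S, hS⟩ := exists_partialDeriv_eq_zero L
  have h := sum_mul_formalDerivs_sub_mem hS Q
  simpa only [evolution_eq_sum Q hS, euler, mul_comm] using h

/-- Since $\mathrm{pr}_Q$ commutes with $D_\sigma$, it can be applied to the potentials
$\mu^\sigma$. -/
theorem evolution_mem_divergences (Q : Fin m → smoothJets O) {f : smoothJets O}
    (hf : f ∈ divergences n m O) : evolution Q f ∈ divergences n m O := by
  obtain ⟨μ, rfl⟩ := mem_divergences.1 hf
  refine mem_divergences.2 ⟨fun σ => evolution Q (μ σ), ?_⟩
  simp only [map_sum, evolution_formalDeriv]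

/-- The second vertical differential of `L` contracted with the prolongation of `Q`. -/
def hessianCoeff (Q : Fin m → smoothJets O) (L : smoothJets O) (α : Fin n → ℕ) (i : Fin m) :
    smoothJets O :=
  ∑ᶠ b : (Fin n → ℕ) × Fin m,
    partialDeriv O (.inr (α, i)) (partialDeriv O (.inr b) L) * formalDerivs O b.1 (Q b.2)

theorem hessianCoeff_eq_sum (Q : Fin m → smoothJets O) {L : smoothJets O}
    {S : Finset (Fin n → ℕ)} (hS : ∀ α ∉ S, ∀ i, partialDeriv O (.inr (α, i)) L = 0)
    (α : Fin n → ℕ) (i : Fin m) :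
    hessianCoeff Q L α i = ∑ β ∈ S, ∑ j, partialDeriv O (.inr (α, i))
      (partialDeriv O (.inr (β, j)) L) * formalDerivs O β (Q j) := by
  rw [hessianCoeff, finsum_eq_sum_of_support_subset (s := S ×ˢ Finset.univ), Finset.sum_product]
  rintro ⟨β, j⟩ hb
  have : β ∈ S := by
    by_contra h
    exact hb (by beta_reduce; rw [hS β h, map_zero, zero_mul])
  simp [this]

theorem hessianCoeff_eq_zero (Q : Fin m → smoothJets O) {L : smoothJets O}
    {S : Finset (Fin n → ℕ)} (hS : ∀ α ∉ S, ∀ i, partialDeriv O (.inr (α, i)) L = 0)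
    {α : Fin n → ℕ} (hα : α ∉ S) (i : Fin m) : hessianCoeff Q L α i = 0 := by
  rw [hessianCoeff_eq_sum Q hS]
  refine Finset.sum_eq_zero fun β _ => Finset.sum_eq_zero fun j _ => ?_
  rw [partialDeriv_comm, hS α hα, map_zero, zero_mul]

/-- The adjoint linearization of the Euler–Lagrange operator agrees with the source form of the
second vertical differential: both are the Jacobi operator. -/
theorem sum_eulerPair_euler (Q : Fin m → smoothJets O) (L : smoothJets O) (i : Fin m) :
    ∑ j, eulerPair O i (euler O j L) (Q j) = adjointSum fun α => hessianCoeff Q L α i := by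
  obtain ⟨S, hS⟩ := exists_partialDeriv_eq_zero L
  have hS' : ∀ c, ∀ α ∉ S, ∀ k, partialDeriv O (.inr (α, k)) (partialDeriv O c L) = 0 :=
    fun c α hα k => by rw [partialDeriv_comm, hS α hα, map_zero]
  have h₁ : ∀ j, eulerPair O i (euler O j L) (Q j) =
      ∑ β ∈ S, eulerPair O i (partialDeriv O (.inr (β, j)) L) (formalDerivs O β (Q j)) := by
    intro j
    rw [euler, adjointSum_eq_sum fun α hα => hS α hα j, map_sum, LinearMap.sum_apply]
    refine Finset.sum_congr rfl fun β _ => ?_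
    -- Moving $D_\beta$ onto $Q^j$ produces a second factor $(-1)^{|\beta|}$, which cancels the one
    -- in the Euler operator.
    rw [map_smul, LinearMap.smul_apply, eulerPair_formalDerivs, smul_smul, ← mul_pow]
    simp
  simp only [h₁]
  rw [adjointSum_eq_sum fun α hα => hessianCoeff_eq_zero Q hS hα i, Finset.sum_comm]
  simp only [hessianCoeff_eq_sum Q hS, map_sum, Finset.smul_sum, eulerPair_eq_sum i (hS' _)]
  rw [Finset.sum_comm (s := S) (t := S)]
  refine Finset.sum_congr rfl fun β _ => ?_
  rw [Finset.sum_comm]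

end EulerOperators

/-! ### From the jet algebra back to the coordinate formulas -/

section Transfer

variable {n m : ℕ} {O : TopologicalSpace.Opens ((Fin n → ℝ) × (Fin m → ℝ))}

theorem Represents.finsum {ι : Type*} {F : ι → Jet n m → ℝ} {f : ι → smoothJets O}
    (hF : ∀ a, Represents (F a) (f a)) {T : Finset ι} (hT : ∀ a ∉ T, f a = 0) :
    Represents (fun p => ∑ᶠ a, F a p) (∑ a ∈ T, f a) := fun p => by
  refine Eq.trans ?_ (Represents.sum (fun a (_ : a ∈ T) => hF a) p)
  refine finsum_eq_sum_of_support_subset _ fun a ha => ?_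
  by_contra h
  refine ha ?_
  beta_reduce
  rw [hF a p, hT a h]
  rfl

theorem formalDeriv_eq_sum (σ : Fin n) {f : smoothJets O}
    {S : Finset (Fin n → ℕ)} (hS : ∀ α ∉ S, ∀ i, partialDeriv O (.inr (α, i)) f = 0) :
    formalDeriv O σ f = partialDeriv O (.inl σ) f + ∑ a ∈ S ×ˢ Finset.univ,
      coordFn O (.inr (a.1 + Pi.single σ 1, a.2)) * partialDeriv O (.inr a) f := by
  classical
  rw [formalDeriv, vectorField_eq_sum (T := Finset.univ.disjSum (S ×ˢ Finset.univ))]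
  · rw [Finset.sum_disjSum]
    simp [totalCoeff]
  · rintro (σ | ⟨α, i⟩) h
    · simp at h
    · exact hS α (fun hα => h (by simp [hα])) i

theorem Represents.totalDeriv {F : Jet n m → ℝ} {f : smoothJets O} (hF : Represents F f)
    (σ : Fin n) : Represents (totalDeriv σ F) (formalDeriv O σ f) := by
  obtain ⟨S, hS⟩ := exists_partialDeriv_eq_zero f
  rw [formalDeriv_eq_sum σ hS]
  refine (hF.pderivBase σ).add (Represents.finsum (fun a => ?_) ?_)
  · exact (represents_coordFn_inr (a.1 + Pi.single σ 1, a.2)).mul (hF.pderivJet a.1 a.2)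
  · rintro ⟨α, i⟩ h
    rw [hS α (fun hα => h (by simp [hα])) i, mul_zero]

theorem Represents.totalDerivs {F : Jet n m → ℝ} {f : smoothJets O} (hF : Represents F f)
    (α : Fin n → ℕ) : Represents (totalDerivs α F) (formalDerivs O α f) :=
  iter_rel Represents (fun σ _ _ h => h.totalDeriv σ) α hF

theorem represents_sourceForm {a : (Fin n → ℕ) → Fin m → Jet n m → ℝ}
    {a' : (Fin n → ℕ) → Fin m → smoothJets O} {S : Finset (Fin n → ℕ)} (i : Fin m)
    (ha : ∀ α, Represents (a α i) (a' α i)) (hS : ∀ α ∉ S, a' α i = 0) :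
    Represents (sourceForm a i) (adjointSum fun α => a' α i) := by
  rw [adjointSum_eq_sum hS]
  refine Represents.finsum (fun α => ((ha α).totalDerivs α).const_mul _) fun α hα => ?_
  rw [hS α hα, map_zero, smul_zero]

theorem Represents.eulerLagrange {F : Jet n m → ℝ} {f : smoothJets O} (hF : Represents F f)
    (i : Fin m) : Represents (eulerLagrange F i) (euler O i f) := by
  obtain ⟨S, hS⟩ := exists_partialDeriv_eq_zero f
  exact represents_sourceForm i (a' := fun α i => partialDeriv O (.inr (α, i)) f)
    (fun α => hF.pderivJet α i) fun α hα => hS α hα i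

theorem Represents.prolong {Q : Fin m → Jet n m → ℝ} {q : Fin m → smoothJets O}
    (hQ : ∀ i, Represents (Q i) (q i)) {F : Jet n m → ℝ} {f : smoothJets O}
    (hF : Represents F f) : Represents (prolong Q F) (evolution q f) := by
  obtain ⟨S, hS⟩ := exists_partialDeriv_eq_zero f
  rw [evolution_eq_sum q hS, ← Finset.sum_product']
  refine Represents.finsum (f := fun a => formalDerivs O a.1 (q a.2) * partialDeriv O (.inr a) f)
    (fun a => ((hQ a.2).totalDerivs a.1).mul (hF.pderivJet a.1 a.2)) ?_
  rintro ⟨α, i⟩ h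
  rw [hS α (fun hα => h (by simp [hα])) i, mul_zero]

theorem represents_contract {Q E : Fin m → Jet n m → ℝ} {q e : Fin m → smoothJets O}
    (hQ : ∀ i, Represents (Q i) (q i)) (hE : ∀ i, Represents (E i) (e i)) :
    Represents (contract Q E) (∑ i, q i * e i) :=
  Represents.sum fun i _ => (hQ i).mul (hE i)

theorem represents_hessianForm {Q : Fin m → Jet n m → ℝ} {q : Fin m → smoothJets O}
    (hQ : ∀ i, Represents (Q i) (q i)) {F : Jet n m → ℝ} {f : smoothJets O}
    (hF : Represents F f) (α : Fin n → ℕ) (i : Fin m) :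
    Represents (hessianForm Q F α i) (hessianCoeff q f α i) := by
  obtain ⟨S, hS⟩ := exists_partialDeriv_eq_zero f
  rw [hessianCoeff_eq_sum q hS, ← Finset.sum_product']
  refine Represents.finsum (f := fun b : (Fin n → ℕ) × Fin m =>
      partialDeriv O (.inr (α, i)) (partialDeriv O (.inr b) f) * formalDerivs O b.1 (q b.2))
    (fun b => ((hF.pderivJet b.1 b.2).pderivJet α i).mul ((hQ b.2).totalDerivs b.1)) ?_
  rintro ⟨β, j⟩ h
  rw [hS β (fun hβ => h (by simp [hβ])) j, map_zero, zero_mul]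

theorem represents_sourceForm_hessianForm {Q : Fin m → Jet n m → ℝ} {q : Fin m → smoothJets O}
    (hQ : ∀ i, Represents (Q i) (q i)) {F : Jet n m → ℝ} {f : smoothJets O}
    (hF : Represents F f) (i : Fin m) :
    Represents (sourceForm (hessianForm Q F) i) (adjointSum fun α => hessianCoeff q f α i) := by
  obtain ⟨S, hS⟩ := exists_partialDeriv_eq_zero f
  exact represents_sourceForm i (fun α => represents_hessianForm hQ hF α i) fun α hα =>
    hessianCoeff_eq_zero q hS hα i

/-- Integrating by parts removes every $D_\alpha$ from the second variation field, which leaves the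
pairing with the Jacobi expression. -/
theorem exists_represents_hessian {Q w : Fin m → Jet n m → ℝ} {q u : Fin m → smoothJets O}
    (hQ : ∀ i, Represents (Q i) (q i)) (hw : ∀ i, Represents (w i) (u i)) {F : Jet n m → ℝ}
    {f : smoothJets O} (hF : Represents F f) :
    ∃ h : smoothJets O, Represents (hessian Q w F) h ∧
      h - ∑ i, (adjointSum fun α => hessianCoeff q f α i) * u i ∈ divergences n m O := by
  obtain ⟨S, hS⟩ := exists_partialDeriv_eq_zero f
  have hc : ∀ α ∉ S, ∀ i, hessianCoeff q f α i = 0 := fun α hα i => hessianCoeff_eq_zero q hS hα i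
  refine ⟨_, ?_, sum_mul_formalDerivs_sub_mem hc u⟩
  have h := Represents.finsum (T := S ×ˢ (Finset.univ : Finset (Fin m)))
    (F := fun a : (Fin n → ℕ) × Fin m => fun p =>
      hessianForm Q F a.1 a.2 p * GaugeNatural.totalDerivs a.1 (w a.2) p)
    (f := fun a => hessianCoeff q f a.1 a.2 * formalDerivs O a.1 (u a.2))
    (fun a => (represents_hessianForm hQ hF a.1 a.2).mul ((hw a.2).totalDerivs a.1))
    (fun a h => by rw [hc a.1 (fun hα => h (by simp [hα])) a.2, zero_mul])
  rw [Finset.sum_product] at h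
  exact h

/-- With $E=E(L)$ this recognizes the Bianchi morphism of sense (A) as minus the adjoint
linearization of the Euler–Lagrange expressions, applied to $Q$. -/
theorem represents_sourceForm_pderivJet {Q E : Fin m → Jet n m → ℝ} {q e : Fin m → smoothJets O}
    (hQ : ∀ i, Represents (Q i) (q i)) (hE : ∀ i, Represents (E i) (e i)) (i : Fin m) :
    Represents (sourceForm (fun α k p => ∑ j, -Q j p * pderivJet α k (E j) p) i)
      (-∑ j, eulerPair O i (e j) (q j)) := by
  choose S hS using fun j => exists_partialDeriv_eq_zero (e j)
  classical
  have hT : ∀ j, ∀ α ∉ Finset.univ.biUnion S, ∀ k, partialDeriv O (.inr (α, k)) (e j) = 0 :=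
    fun j α hα k => hS j α (fun h => hα (Finset.mem_biUnion.2 ⟨j, Finset.mem_univ j, h⟩)) k
  have h := represents_sourceForm (S := Finset.univ.biUnion S)
    (a := fun α k p => ∑ j, -Q j p * GaugeNatural.pderivJet α k (E j) p)
    (a' := fun α k => ∑ j, -q j * partialDeriv O (.inr (α, k)) (e j)) i
    (fun α => Represents.sum fun j _ => (hQ j).neg.mul ((hE j).pderivJet α i))
    (fun α hα => Finset.sum_eq_zero fun j _ => by rw [hT j α hα, mul_zero])
  convert h using 1
  rw [adjointSum_eq_sum (S := Finset.univ.biUnion S)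
    (fun α hα => Finset.sum_eq_zero fun j _ => by rw [hT j α hα, mul_zero])]
  simp only [eulerPair_eq_sum i (hT _), map_sum, Finset.smul_sum]
  rw [Finset.sum_comm, ← Finset.sum_neg_distrib]
  refine Finset.sum_congr rfl fun α _ => ?_
  rw [← Finset.sum_neg_distrib]
  refine Finset.sum_congr rfl fun j _ => ?_
  rw [neg_mul (q j), map_neg, smul_neg, mul_comm]

theorem Represents.isLocalDivergence {F : Jet n m → ℝ} {f : smoothJets O} (hF : Represents F f)
    (hf : f ∈ divergences n m O) : IsLocalDivergence O F := by
  obtain ⟨μ, hμ⟩ := mem_divergences.1 hf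
  choose k hk using fun σ => (represents_extend (μ σ)).exists_isJetSmooth
  intro z hz
  refine ⟨O, O.isOpen, hz, subset_rfl, Finset.univ.sup k, fun σ => extend (μ σ), fun σ =>
    (hk σ).mono_order (Finset.le_sup (Finset.mem_univ σ)), fun p hp => ?_⟩
  have h := Represents.sum fun σ (_ : σ ∈ Finset.univ) => (represents_extend (μ σ)).totalDeriv σ
  rw [hμ] at h
  exact (hF ⟨p, hp⟩).trans (h ⟨p, hp⟩).symm

end Transfer

/-! ### Test variations formally flat at a prescribed jet -/

section TestVariations

variable {n m : ℕ} {O : TopologicalSpace.Opens ((Fin n → ℝ) × (Fin m → ℝ))}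

/-- The formal derivatives of order at most `N` vanish at `p`. -/
def VanishesToOrder (p : jetsOver (O : Set ((Fin n → ℝ) × (Fin m → ℝ)))) :
    ℕ → smoothJets O → Prop
  | 0, f => f.1 p = 0
  | N + 1, f => f.1 p = 0 ∧ ∀ σ, VanishesToOrder p N (formalDeriv O σ f)

variable {p : jetsOver (O : Set ((Fin n → ℝ) × (Fin m → ℝ)))}

theorem VanishesToOrder.eval {N : ℕ} {f : smoothJets O} (h : VanishesToOrder p N f) :
    f.1 p = 0 := by
  cases N with
  | zero => exact h
  | succ N => exact h.1

theorem VanishesToOrder.of_succ {N : ℕ} {f : smoothJets O} (h : VanishesToOrder p (N + 1) f) :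
    VanishesToOrder p N f := by
  induction N generalizing f with
  | zero => exact h.1
  | succ N ih => exact ⟨h.1, fun σ => ih (h.2 σ)⟩

theorem VanishesToOrder.add {N : ℕ} {f g : smoothJets O} (hf : VanishesToOrder p N f)
    (hg : VanishesToOrder p N g) : VanishesToOrder p N (f + g) := by
  induction N generalizing f g with
  | zero =>
    change f.1 p + g.1 p = 0
    rw [hf.eval, hg.eval, add_zero]
  | succ N ih =>
    refine ⟨?_, fun σ => ?_⟩
    · change f.1 p + g.1 p = 0
      rw [hf.eval, hg.eval, add_zero]
    · rw [map_add]
      exact ih (hf.2 σ) (hg.2 σ)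

/-- Leibniz: functions flat to order `N` at `p` form an ideal. -/
theorem VanishesToOrder.mul_left {N : ℕ} {w : smoothJets O} (hw : VanishesToOrder p N w)
    (g : smoothJets O) : VanishesToOrder p N (g * w) := by
  induction N generalizing g w with
  | zero =>
    change g.1 p * w.1 p = 0
    rw [hw.eval, mul_zero]
  | succ N ih =>
    refine ⟨?_, fun σ => ?_⟩
    · change g.1 p * w.1 p = 0
      rw [hw.eval, mul_zero]
    · rw [Derivation.leibniz, smul_eq_mul, smul_eq_mul, mul_comm w]
      exact (ih (hw.2 σ) g).add (ih hw.of_succ _)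

theorem VanishesToOrder.formalDerivs_eval {N : ℕ} {w : smoothJets O}
    (hw : VanishesToOrder p N w) {α : Fin n → ℕ} (hα : degree α ≤ N) :
    (formalDerivs O α w).1 p = 0 := by
  induction α using multiIndex_induction generalizing N w with
  | h0 => rw [formalDerivs_zero]; exact hw.eval
  | hs α σ ih =>
    rw [degree_add_single] at hα
    obtain ⟨M, rfl⟩ : ∃ M, N = M + 1 := ⟨N - 1, by omega⟩
    rw [formalDerivs_add_single, formalDeriv_formalDerivs]
    exact ih (hw.2 σ) (by omega)

/-- The Euler–Lagrange expression of `w g` recovers `g` at a point where `w` is flat with unit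
derivative along the fibre. -/
theorem euler_mul_eval {N : ℕ} {w g : smoothJets O} {i : Fin m}
    (hg : ∀ α ∉ multiIndices n N, ∀ k, partialDeriv O (.inr (α, k)) g = 0)
    (hw : VanishesToOrder p N w) (hw₁ : partialDeriv O (.inr (0, i)) w = 1)
    (hw₀ : ∀ α ≠ 0, ∀ k, partialDeriv O (.inr (α, k)) w = 0) :
    (euler O i (g * w)).1 p = g.1 p := by
  have h₁ : eulerPair O i w g = g := by
    rw [eulerPair_eq_sum (S := {0}) i fun α hα => hw₀ α (by simpa using hα),
      Finset.sum_singleton, hw₁, one_mul, degree_zero, formalDerivs_zero, pow_zero, one_smul]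
  -- Only multi-indices of degree at most `N`, the order of `g`, contribute, and those derivatives
  -- of a multiple of `w` vanish at `p`.
  have h₂ : (eulerPair O i g w).1 p = 0 := by
    rw [eulerPair_eq_sum i hg, AddSubmonoidClass.coe_finsetSum, Finset.sum_apply]
    refine Finset.sum_eq_zero fun α hα => ?_
    have := (hw.mul_left (partialDeriv O (.inr (α, i)) g)).formalDerivs_eval
      (mem_multiIndices.1 hα)
    change _ * (formalDerivs O α _).1 p = 0
    rw [this, mul_zero]
  rw [euler_mul, h₁]
  change (eulerPair O i g w).1 p + g.1 p = g.1 p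
  rw [h₂, zero_add]

variable (O) in
/-- The divided powers of `x^τ - c`. -/
def dividedPower (τ : Fin n) (c : ℝ) (k : ℕ) : smoothJets O :=
  (k.factorial : ℝ)⁻¹ • (coordFn O (.inl τ) - algebraMap ℝ _ c) ^ k

variable (O) in
/-- The divided monomials in `x - c`. -/
def dividedMonomial (c : Fin n → ℝ) (β : Fin n → ℕ) : smoothJets O :=
  ∏ τ, dividedPower O τ (c τ) (β τ)

/-- Dividing by the factorial makes $D_\sigma$ a pure index shift, so jet coordinates serve directly
as Taylor coefficients. -/
theorem formalDeriv_dividedPower_succ (σ : Fin n) (c : ℝ) (k : ℕ) :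
    formalDeriv O σ (dividedPower O σ c (k + 1)) = dividedPower O σ c k := by
  rw [dividedPower, dividedPower, Derivation.map_smul, Derivation.leibniz_pow, map_sub,
    Derivation.map_algebraMap, sub_zero, formalDeriv_coordFn_inl, if_pos rfl, smul_eq_mul, mul_one,
    Nat.add_sub_cancel, ← Nat.cast_smul_eq_nsmul ℝ, smul_smul, Nat.factorial_succ]
  congr 1
  have : ((k + 1 : ℕ) : ℝ) ≠ 0 := by positivity
  have : (k.factorial : ℝ) ≠ 0 := by positivity
  push_cast at *
  field_simp

theorem formalDeriv_dividedPower_of_ne {σ τ : Fin n} (h : τ ≠ σ) (c : ℝ) (k : ℕ) :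
    formalDeriv O σ (dividedPower O τ c k) = 0 := by
  rw [dividedPower, Derivation.map_smul, Derivation.leibniz_pow, map_sub,
    Derivation.map_algebraMap, sub_zero, formalDeriv_coordFn_inl, if_neg h]
  simp

theorem formalDeriv_dividedPower_zero (σ τ : Fin n) (c : ℝ) :
    formalDeriv O σ (dividedPower O τ c 0) = 0 := by
  simp [dividedPower]

theorem derivation_prod_eq_zero {R A ι : Type*} [CommRing R] [CommRing A] [Algebra R A]
    (D : Derivation R A A) {s : Finset ι} {f : ι → A} (h : ∀ a ∈ s, D (f a) = 0) :
    D (∏ a ∈ s, f a) = 0 :=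
  Finset.prod_induction f (fun a => D a = 0)
    (fun a b ha hb => by rw [Derivation.leibniz, ha, hb]; simp) (by simp) h

theorem formalDeriv_dividedMonomial (σ : Fin n) (c : Fin n → ℝ) (β : Fin n → ℕ) :
    formalDeriv O σ (dividedMonomial O c β) =
      formalDeriv O σ (dividedPower O σ (c σ) (β σ)) *
        ∏ τ ∈ Finset.univ.erase σ, dividedPower O τ (c τ) (β τ) := by
  rw [dividedMonomial, ← Finset.mul_prod_erase _ _ (Finset.mem_univ σ), Derivation.leibniz,
    derivation_prod_eq_zero (formalDeriv O σ)]
  · simp [mul_comm]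
  · intro τ hτ
    exact formalDeriv_dividedPower_of_ne (Finset.ne_of_mem_erase hτ) _ _

theorem formalDeriv_dividedMonomial_add_single (σ : Fin n) (c : Fin n → ℝ) (β : Fin n → ℕ) :
    formalDeriv O σ (dividedMonomial O c (β + Pi.single σ 1)) = dividedMonomial O c β := by
  rw [formalDeriv_dividedMonomial, dividedMonomial,
    ← Finset.mul_prod_erase _ _ (Finset.mem_univ σ)]
  congr 1
  · rw [Pi.add_apply, Pi.single_eq_same, formalDeriv_dividedPower_succ]
  · refine Finset.prod_congr rfl fun τ hτ => ?_
    rw [Pi.add_apply, Pi.single_eq_of_ne (Finset.ne_of_mem_erase hτ), add_zero]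

theorem formalDeriv_dividedMonomial_of_eq_zero {σ : Fin n} {β : Fin n → ℕ} (hβ : β σ = 0)
    (c : Fin n → ℝ) : formalDeriv O σ (dividedMonomial O c β) = 0 := by
  rw [formalDeriv_dividedMonomial, hβ, formalDeriv_dividedPower_zero, zero_mul]

theorem partialDeriv_dividedMonomial (a : (Fin n → ℕ) × Fin m) (c : Fin n → ℝ)
    (β : Fin n → ℕ) : partialDeriv O (.inr a) (dividedMonomial O c β) = 0 := by
  classical
  refine derivation_prod_eq_zero _ fun τ _ => ?_
  rw [dividedPower, Derivation.map_smul, Derivation.leibniz_pow, map_sub,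
    Derivation.map_algebraMap, sub_zero, partialDeriv_coordFn]
  simp

theorem represents_dividedMonomial (c : Fin n → ℝ) (β : Fin n → ℕ) :
    Represents (fun p : Jet n m => ∏ τ, (((β τ).factorial : ℝ)⁻¹ * (p.1 τ - c τ) ^ β τ))
      (dividedMonomial O c β) := fun p => by
  rw [dividedMonomial, SubmonoidClass.coe_finsetProd, Finset.prod_apply]
  rfl

variable (O) in
/-- The difference of the coordinate `y^i_γ` and of the Taylor polynomial of order `N` at `p`. -/
def taylorRemainder (p : Jet n m) (i : Fin m) (N : ℕ) (γ : Fin n → ℕ) : smoothJets O :=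
  coordFn O (.inr (γ, i)) - ∑ β ∈ multiIndices n N, p.2 (γ + β) i • dividedMonomial O p.1 β

theorem taylorRemainder_eval (i : Fin m) (N : ℕ) (γ : Fin n → ℕ) :
    (taylorRemainder O p.1 i N γ).1 p = 0 := by
  have h := (represents_coordFn_inr (O := O) (γ, i)).add (Represents.sum
    fun β (_ : β ∈ multiIndices n N) =>
      (represents_dividedMonomial (O := O) p.1.1 β).const_mul (p.1.2 (γ + β) i)).neg
  rw [taylorRemainder, sub_eq_add_neg]
  refine (h p).symm.trans ?_
  beta_reduce
  rw [Finset.sum_eq_single (0 : Fin n → ℕ)]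
  · simp
  · intro β _ hβ
    obtain ⟨σ, hσ⟩ := Function.ne_iff.1 hβ
    rw [Finset.prod_eq_zero (Finset.mem_univ σ), mul_zero]
    rw [sub_self, zero_pow hσ, mul_zero]
  · exact fun h => absurd (zero_mem_multiIndices n N) h

/-- The family of remainders is closed under $D_\sigma$: the order drops by one and `γ` is shifted.
This is why `γ` is kept general although only `γ = 0` is used as a variation. -/
theorem formalDeriv_taylorRemainder (p : Jet n m) (i : Fin m) (N : ℕ) (γ : Fin n → ℕ)
    (σ : Fin n) : formalDeriv O σ (taylorRemainder O p i (N + 1) γ) =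
      taylorRemainder O p i N (γ + Pi.single σ 1) := by
  classical
  have hinj : Function.Injective fun β : Fin n → ℕ => β + Pi.single σ 1 := add_left_injective _
  rw [taylorRemainder, taylorRemainder, map_sub, formalDeriv_coordFn_inr, map_sum]
  congr 1
  rw [← Finset.sum_subset (s₁ := (multiIndices n N).image fun β => β + Pi.single σ 1),
    Finset.sum_image hinj.injOn]
  · refine Finset.sum_congr rfl fun β _ => ?_
    rw [Derivation.map_smul, formalDeriv_dividedMonomial_add_single, add_assoc,
      add_comm (Pi.single σ 1)]
  · intro β hβ
    obtain ⟨β', hβ', rfl⟩ := Finset.mem_image.1 hβ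
    rw [mem_multiIndices] at hβ' ⊢
    rw [degree_add_single]
    omega
  -- Multi-indices outside the image of the shift have zero entry at `σ`, and their monomials are
  -- killed by $D_\sigma$.
  · intro β hβ hβ'
    rw [Derivation.map_smul, formalDeriv_dividedMonomial_of_eq_zero, smul_zero]
    by_contra h0
    have hα' : (β - Pi.single σ 1) + Pi.single σ 1 = β := funext fun τ => by
      by_cases hτ : τ = σ
      · subst hτ; simp; omega
      · simp [hτ]
    refine hβ' (Finset.mem_image.2 ⟨β - Pi.single σ 1, ?_, hα'⟩)
    rw [mem_multiIndices] at hβ ⊢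
    rw [← hα', degree_add_single] at hβ
    omega

theorem vanishesToOrder_taylorRemainder (i : Fin m) (N : ℕ) (γ : Fin n → ℕ) :
    VanishesToOrder p N (taylorRemainder O p.1 i N γ) := by
  induction N generalizing γ with
  | zero => exact taylorRemainder_eval i 0 γ
  | succ N ih =>
    refine ⟨taylorRemainder_eval i _ γ, fun σ => ?_⟩
    rw [formalDeriv_taylorRemainder]
    exact ih _

open Classical in
theorem partialDeriv_taylorRemainder (p : Jet n m) (i : Fin m) (N : ℕ) (γ : Fin n → ℕ)
    (a : (Fin n → ℕ) × Fin m) :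
    partialDeriv O (.inr a) (taylorRemainder O p i N γ) = if (γ, i) = a then 1 else 0 := by
  rw [taylorRemainder, map_sub, map_sum, Finset.sum_eq_zero, sub_zero, partialDeriv_coordFn]
  · simp
  · intro β _
    rw [Derivation.map_smul, partialDeriv_dividedMonomial, smul_zero]

/-- The function represented by `taylorRemainder` at `γ = 0`. -/
def taylorVariation (p : Jet n m) (i : Fin m) (N : ℕ) : Jet n m → ℝ := fun q =>
  q.2 0 i + -∑ β ∈ multiIndices n N,
    p.2 (0 + β) i * ∏ τ, (((β τ).factorial : ℝ)⁻¹ * (q.1 τ - p.1 τ) ^ β τ)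

theorem represents_taylorVariation (p : Jet n m) (i : Fin m) (N : ℕ) :
    Represents (taylorVariation p i N) (taylorRemainder O p i N 0) := by
  rw [taylorRemainder, sub_eq_add_neg]
  exact (represents_coordFn_inr (O := O) (0, i)).add (Represents.sum
    fun β (_ : β ∈ multiIndices n N) =>
      (represents_dividedMonomial (O := O) p.1 β).const_mul (p.2 (0 + β) i)).neg

/-- The jet coordinates of `p` enter only as constants, so the variation depends on $x$ and $y$
alone and is admissible in the second variation. -/
theorem isJetSmooth_taylorVariation (p : Jet n m) (i : Fin m) (N : ℕ)
    (V : Set ((Fin n → ℝ) × (Fin m → ℝ))) : IsJetSmooth 0 V (taylorVariation p i N) := by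
  refine ⟨fun q => q.2 ⟨0, zero_mem_multiIndices n 0⟩ i + -∑ β ∈ multiIndices n N,
    p.2 (0 + β) i * ∏ τ, (((β τ).factorial : ℝ)⁻¹ * (q.1 τ - p.1 τ) ^ β τ),
    ContDiff.contDiffOn ?_, fun _ _ => rfl⟩
  refine ContDiff.add (by fun_prop) (ContDiff.neg (ContDiff.sum fun β _ => ?_))
  exact contDiff_const.mul (contDiff_prod fun τ _ => by fun_prop)

end TestVariations

/-! ### The fundamental lemma and the consequences of invariance in a chart -/

section LocalEquivalences

variable {n m : ℕ} {O : Set ((Fin n → ℝ) × (Fin m → ℝ))}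

/-- The Hessian is $\mathcal J_iw^i$ up to a divergence. Testing with a variation flat at `p`, and
applying the Euler operator to discard the divergence, isolates $\mathcal J_i(p)$ without compactly
supported variations or integration. -/
theorem isLocalDivergence_hessian_iff (hO : IsOpen O) {r s : ℕ} {Q : Fin m → Jet n m → ℝ}
    {L : Jet n m → ℝ} (hQ : ∀ i, IsJetSmooth r O (Q i)) (hL : IsJetSmooth s O L) :
    (∀ w : Fin m → Jet n m → ℝ, (∀ i, IsJetSmooth 0 O (w i)) →
        IsLocalDivergence O (hessian Q w L)) ↔
      ∀ i, ∀ p ∈ jetsOver O, sourceForm (hessianForm Q L) i p = 0 := by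
  let O' : TopologicalSpace.Opens ((Fin n → ℝ) × (Fin m → ℝ)) := ⟨O, hO⟩
  choose q hq using fun i => (show IsJetSmooth r O' (Q i) from hQ i).exists_represents
  obtain ⟨l, hl⟩ := (show IsJetSmooth s O' L from hL).exists_represents
  have hJ := represents_sourceForm_hessianForm hq hl
  constructor
  · intro h i p hp
    -- The flatness order of the test variation must be at least the jet order of $\mathcal J_i$.
    obtain ⟨N, hN⟩ := (hJ i).exists_isJetSmooth
    classical
    set w : Fin m → Jet n m → ℝ := Pi.single i (taylorVariation p i N) with hw
    have hw₀ : ∀ V, ∀ j, IsJetSmooth 0 V (w j) := by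
      intro V j
      by_cases hj : j = i
      · subst hj
        rw [hw, Pi.single_eq_same]
        exact isJetSmooth_taylorVariation p j N V
      · rw [hw, Pi.single_eq_of_ne hj]
        exact ⟨fun _ => 0, contDiffOn_const, fun _ _ => rfl⟩
    -- The divergence is only local, so the argument is carried out in the jet algebra of a smaller
    -- neighbourhood `V`.
    obtain ⟨V, hVo, hpV, hVO, k, μ, hμ, hdiv⟩ := h w (hw₀ O) _ hp
    let V' : TopologicalSpace.Opens ((Fin n → ℝ) × (Fin m → ℝ)) := ⟨V, hVo⟩
    choose q' hq' using fun i =>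
      (show IsJetSmooth r V' (Q i) from (hQ i).mono hVO).exists_represents
    obtain ⟨l', hl'⟩ := (show IsJetSmooth s V' L from hL.mono hVO).exists_represents
    choose μ' hμ' using fun σ => (show IsJetSmooth k V' (μ σ) from hμ σ).exists_represents
    set u : Fin m → smoothJets V' := Pi.single i (taylorRemainder V' p i N 0) with hu
    have hwu : ∀ j, Represents (w j) (u j) := by
      intro j
      by_cases hj : j = i
      · subst hj
        rw [hw, hu, Pi.single_eq_same, Pi.single_eq_same]
        exact represents_taylorVariation p j N
      · rw [hw, hu, Pi.single_eq_of_ne hj, Pi.single_eq_of_ne hj]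
        exact fun _ => rfl
    have hJ' := represents_sourceForm_hessianForm hq' hl' i
    obtain ⟨h', hh', hmem⟩ := exists_represents_hessian hq' hwu hl'
    have hh'' : h' ∈ divergences n m V' := by
      refine mem_divergences.2 ⟨μ', Represents.unique (F := hessian Q w L) (fun x => ?_) hh'⟩
      rw [hdiv x x.2]
      exact Represents.sum (fun σ _ => (hμ' σ).totalDeriv σ) x
    have hsum : ∑ j, (adjointSum fun α => hessianCoeff q' l' α j) * u j =
        (adjointSum fun α => hessianCoeff q' l' α i) * taylorRemainder V' p i N 0 := by
      rw [Finset.sum_eq_single i]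
      · rw [hu, Pi.single_eq_same]
      · intro j _ hj
        rw [hu, Pi.single_eq_of_ne hj, mul_zero]
      · simp
    rw [hsum] at hmem
    -- The Hessian is a divergence and differs by one from $\mathcal J_iw^i$, so this product is a
    -- divergence too.
    have hprod := (divergences n m V').sub_mem hh'' hmem
    rw [sub_sub_cancel] at hprod
    have he := euler_eq_zero hprod i
    have hev := euler_mul_eval (O := V') (p := ⟨p, hpV⟩) (N := N) (i := i)
      (fun α hα k => (hN.mono hVO).partialDeriv_eq_zero hJ' hα k)
      (vanishesToOrder_taylorRemainder i N 0) (by simp [partialDeriv_taylorRemainder])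
      (fun α hα k => by simp [partialDeriv_taylorRemainder, hα.symm])
    rw [he] at hev
    exact (hJ' ⟨p, hpV⟩).trans hev.symm
  · intro h w hw
    choose u hu using fun i => (show IsJetSmooth 0 O' (w i) from hw i).exists_represents
    obtain ⟨h', hh', hmem⟩ := exists_represents_hessian hq hu hl
    refine Represents.isLocalDivergence (O := O') hh' ?_
    simpa [fun i => (hJ i).eq_zero_iff.1 (h i)] using hmem

/-- This is `sum_eulerPair_euler` read in coordinates. -/
theorem sourceForm_pderivJet_eulerLagrange_eq_neg (hO : IsOpen O) {r s : ℕ}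
    {Q : Fin m → Jet n m → ℝ} {L : Jet n m → ℝ} (hQ : ∀ i, IsJetSmooth r O (Q i))
    (hL : IsJetSmooth s O L) (i : Fin m) {p : Jet n m} (hp : p ∈ jetsOver O) :
    sourceForm (fun α k p => ∑ j, -Q j p * pderivJet α k (eulerLagrange L j) p) i p =
      -sourceForm (hessianForm Q L) i p := by
  let O' : TopologicalSpace.Opens ((Fin n → ℝ) × (Fin m → ℝ)) := ⟨O, hO⟩
  choose q hq using fun i => (show IsJetSmooth r O' (Q i) from hQ i).exists_represents
  obtain ⟨l, hl⟩ := (show IsJetSmooth s O' L from hL).exists_represents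
  have h₁ := represents_sourceForm_pderivJet hq (fun j => hl.eulerLagrange j) i
  rw [sum_eulerPair_euler] at h₁
  exact (h₁ ⟨p, hp⟩).trans
    ((represents_sourceForm_hessianForm hq hl i).neg ⟨p, hp⟩).symm

/-- The first variation along a vertical field whose prolongation leaves the Lagrangian invariant
up to the divergence `D_σ (ξ^σ L)` is a formal divergence, hence so is `Q ⌋ E(L)`. -/
theorem exists_represents_of_invariant {O : TopologicalSpace.Opens ((Fin n → ℝ) × (Fin m → ℝ))}
    {ξ : Fin n → Jet n m → ℝ} {x : Fin n → smoothJets O} {Q : Fin m → Jet n m → ℝ}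
    {q : Fin m → smoothJets O} {L : Jet n m → ℝ} {l : smoothJets O}
    (hξ : ∀ σ, Represents (ξ σ) (x σ)) (hQ : ∀ i, Represents (Q i) (q i)) (hL : Represents L l)
    (hinv : ∀ p ∈ jetsOver (O : Set ((Fin n → ℝ) × (Fin m → ℝ))),
      (∑ σ, ξ σ p * totalDeriv σ L p) + prolong Q L p + L p * ∑ σ, totalDeriv σ (ξ σ) p = 0) :
    evolution q l ∈ divergences n m O ∧ ∑ i, q i * euler O i l ∈ divergences n m O := by
  have h := ((Represents.sum fun σ (_ : σ ∈ Finset.univ) => (hξ σ).mul (hL.totalDeriv σ)).add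
    (Represents.prolong hQ hL)).add
      (hL.mul (Represents.sum fun σ (_ : σ ∈ Finset.univ) => (hξ σ).totalDeriv σ))
  have h0 := h.eq_zero_iff.1 hinv
  have h₁ : evolution q l ∈ divergences n m O := by
    -- The potential comes from rewriting invariance as $\mathrm{pr}_QL+D_\sigma(\xi^\sigma L)=0$.
    refine mem_divergences.2 ⟨fun σ => -(x σ * l), ?_⟩
    simp only [map_neg, Derivation.leibniz, smul_eq_mul, Finset.sum_neg_distrib,
      Finset.sum_add_distrib]
    rw [Finset.mul_sum] at h0
    linear_combination -h0
  refine ⟨h₁, ?_⟩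
  have h₂ := (divergences n m O).sub_mem h₁ (evolution_sub_mem q l)
  rw [sub_sub_cancel] at h₂
  simpa only [mul_comm] using h₂

end LocalEquivalences

/-! ### Smoothness of the lift and its components in fibered charts -/

section Geometry

variable {n m : ℕ}
  {EH EW : Type*} [NormedAddCommGroup EH] [NormedSpace ℝ EH]
  [NormedAddCommGroup EW] [NormedSpace ℝ EW]
  {X H W F Y : Type*}
  [TopologicalSpace X] [ChartedSpace (Fin n → ℝ) X]
  [TopologicalSpace H] [ChartedSpace EH H] [Group H]
  [TopologicalSpace W] [ChartedSpace EW W]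
  [TopologicalSpace F] [ChartedSpace (Fin m → ℝ) F] [MulAction H F]
  [TopologicalSpace Y] [ChartedSpace ((Fin n → ℝ) × (Fin m → ℝ)) Y]
  {B : PrincipalBundle n EH EW X H W} {A : AssociatedBundle m F Y B}

theorem AssociatedBundle.contMDiff_cls_left (A : AssociatedBundle m F Y B) (f : F) :
    ContMDiff 𝓘(ℝ, EW) 𝓘(ℝ, (Fin n → ℝ) × (Fin m → ℝ)) ∞ fun w => A.cls w f :=
  A.smooth_cls.comp (contMDiff_id.prodMk contMDiff_const)

theorem PrincipalBundle.contMDiff_act_left (B : PrincipalBundle n EH EW X H W) (h : H) :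
    ContMDiff 𝓘(ℝ, EW) 𝓘(ℝ, EW) ∞ fun w => B.act w h :=
  B.smooth_act.comp (contMDiff_id.prodMk contMDiff_const)

theorem AssociatedBundle.cls_act (A : AssociatedBundle m F Y B) (w : W) (h : H) (f : F) :
    A.cls (B.act w h) f = A.cls w (h • f) :=
  ((A.cls_eq_iff w (h • f) (B.act w h) f).2 ⟨h, rfl, rfl⟩).symm

variable [IsManifold 𝓘(ℝ, EW) ∞ W]

/-- Two representatives differ by some `h`, and $[w,h\cdot f]=[w\cdot h,f]$. The chain rule then
reduces the claim to the right invariance of the field. -/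
theorem mfderiv_cls_eq (Ξ : RightInvariantField B) {w w₀ : W} (hw : B.proj w ∈ Ξ.dom) {f f₀ : F}
    (hcls : A.cls w₀ f₀ = A.cls w f) :
    (mfderiv 𝓘(ℝ, EW) 𝓘(ℝ, (Fin n → ℝ) × (Fin m → ℝ)) (fun w' => A.cls w' f₀) w₀
        (Ξ.toFun w₀) : (Fin n → ℝ) × (Fin m → ℝ)) =
      mfderiv 𝓘(ℝ, EW) 𝓘(ℝ, (Fin n → ℝ) × (Fin m → ℝ)) (fun w' => A.cls w' f) w
        (Ξ.toFun w) := by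
  obtain ⟨h, rfl, rfl⟩ := (A.cls_eq_iff w₀ f₀ w f).1 hcls
  rw [B.proj_act] at hw
  rw [← Ξ.invariant w₀ hw h]
  have hfun : (fun w' => A.cls w' (h • f)) = (fun w' => A.cls w' f) ∘ fun w' => B.act w' h :=
    funext fun w' => (A.cls_act w' h f).symm
  rw [hfun]
  exact mfderiv_comp_apply w₀ ((A.contMDiff_cls_left f).mdifferentiable (by simp) _)
    ((B.contMDiff_act_left h).mdifferentiable (by simp) _) _

/-- The lift does not depend on the representative of a class. -/
theorem lift_cls (Ξ : RightInvariantField B) {w : W} (hw : B.proj w ∈ Ξ.dom) (f : F) :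
    lift A Ξ (A.cls w f) =
      mfderiv 𝓘(ℝ, EW) 𝓘(ℝ, (Fin n → ℝ) × (Fin m → ℝ)) (fun w' => A.cls w' f) w (Ξ.toFun w) :=
  mfderiv_cls_eq Ξ hw (A.cls_surjective (A.cls w f)).choose_spec.choose_spec

theorem FiberedChart.isOpen_region (e : FiberedChart A) (Ξ : RightInvariantField B) :
    IsOpen (e.region Ξ) :=
  e.total.isOpen_inter_preimage_symm (Ξ.isOpen_dom.preimage A.smooth_proj.continuous)

theorem Lagrangian.isJetSmooth_region {s : ℕ} (lam : Lagrangian A s)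
    (Ξ : RightInvariantField B) (e : FiberedChart A) :
    IsJetSmooth s (e.region Ξ) (lam.coord e) :=
  (lam.smooth e).mono fun _ hz => hz.1

variable [IsManifold 𝓘(ℝ, Fin m → ℝ) ∞ F]
  [IsManifold 𝓘(ℝ, (Fin n → ℝ) × (Fin m → ℝ)) ∞ Y]

/-- The lift is defined through chosen representatives, which need not vary smoothly. Since the
choice is immaterial, a local section and its trivialization provide smooth ones, and the lift
becomes the tangent map of $(w,f)\mapsto[w,f]$ on a smooth field along them. -/
theorem contMDiffOn_lift (A : AssociatedBundle m F Y B) (Ξ : RightInvariantField B) :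
    ContMDiffOn 𝓘(ℝ, (Fin n → ℝ) × (Fin m → ℝ)) 𝓘(ℝ, (Fin n → ℝ) × (Fin m → ℝ)).tangent ∞
      (fun y => (⟨y, lift A Ξ y⟩ : TangentBundle 𝓘(ℝ, (Fin n → ℝ) × (Fin m → ℝ)) Y))
      (A.proj ⁻¹' Ξ.dom) := by
  intro y₀ hy₀
  obtain ⟨U, s, -, hU, hy₀U, hs, -, hsec, -⟩ := B.locallyTrivial (A.proj y₀)
  obtain ⟨φ, hφ, hcls⟩ := A.trivialization U s hU hs hsec
  set N : Set Y := A.proj ⁻¹' (U ∩ Ξ.dom) with hN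
  have hNo : IsOpen N := (hU.inter Ξ.isOpen_dom).preimage A.smooth_proj.continuous
  have hsp : ContMDiffOn 𝓘(ℝ, (Fin n → ℝ) × (Fin m → ℝ)) 𝓘(ℝ, EW) ∞ (fun y => s (A.proj y)) N :=
    hs.comp A.smooth_proj.contMDiffOn fun y hy => hy.1
  have hΞ : ContMDiffOn 𝓘(ℝ, (Fin n → ℝ) × (Fin m → ℝ)) 𝓘(ℝ, EW).tangent ∞
      (fun y => (⟨s (A.proj y), Ξ.toFun (s (A.proj y))⟩ : TangentBundle 𝓘(ℝ, EW) W)) N :=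
    Ξ.smooth.comp hsp fun y hy => by
      change B.proj (s (A.proj y)) ∈ Ξ.dom
      rw [hsec _ hy.1]
      exact hy.2
  -- The flow moves only the factor `W`, so the component along `F` is the zero vector.
  have hzero : ContMDiffOn 𝓘(ℝ, (Fin n → ℝ) × (Fin m → ℝ)) 𝓘(ℝ, Fin m → ℝ).tangent ∞
      (fun y => (⟨φ y, 0⟩ : TangentBundle 𝓘(ℝ, Fin m → ℝ) F)) N :=
    (Bundle.contMDiff_zeroSection ℝ
      (TangentSpace 𝓘(ℝ, Fin m → ℝ) : F → Type _)).comp_contMDiffOn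
        (hφ.mono fun y hy => hy.1)
  have hG := A.smooth_cls.contMDiff_tangentMap (m := ∞) (by simp)
  have hcomp := (hG.comp (contMDiff_equivTangentBundleProd_symm (I := 𝓘(ℝ, EW))
    (I' := 𝓘(ℝ, Fin m → ℝ)) (n := ∞))).comp_contMDiffOn (hΞ.prodMk hzero)
  have key : ∀ w f, B.proj w ∈ Ξ.dom →
      (⟨A.cls w f, lift A Ξ (A.cls w f)⟩ :
        TangentBundle 𝓘(ℝ, (Fin n → ℝ) × (Fin m → ℝ)) Y) =
      tangentMap (𝓘(ℝ, EW).prod 𝓘(ℝ, Fin m → ℝ)) 𝓘(ℝ, (Fin n → ℝ) × (Fin m → ℝ))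
        (fun q : W × F => A.cls q.1 q.2) ⟨(w, f), (Ξ.toFun w, 0)⟩ := by
    intro w f hw
    rw [lift_cls Ξ hw]
    unfold tangentMap
    congr 1
    rw [mfderiv_prod_eq_add_apply (A.smooth_cls.mdifferentiable (by simp) _)]
    exact (add_eq_left.2 (ContinuousLinearMap.map_zero _)).symm
  have hmem : y₀ ∈ N := ⟨hy₀U, hy₀⟩
  refine ((hcomp.congr fun y hy => ?_).contMDiffAt (hNo.mem_nhds hmem)).contMDiffWithinAt
  refine Eq.trans ?_ (key (s (A.proj y)) (φ y) (by rw [hsec _ hy.1]; exact hy.2))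
  rw [hcls y hy.1]

theorem FiberedChart.contDiffOn_components (e : FiberedChart A) (Ξ : RightInvariantField B) :
    ContDiffOn ℝ ∞ (e.components Ξ) (e.region Ξ) := by
  rw [← contMDiffOn_iff_contDiffOn]
  have h₁ := (contMDiffOn_of_mem_maximalAtlas e.total_mem).contMDiffOn_tangentMapWithin
    (m := ∞) (by simp) e.total.open_source.uniqueMDiffOn
  have h₂ : ContMDiffOn 𝓘(ℝ, (Fin n → ℝ) × (Fin m → ℝ))
      𝓘(ℝ, (Fin n → ℝ) × (Fin m → ℝ)).tangent ∞
      (fun z => (⟨e.total.symm z, lift A Ξ (e.total.symm z)⟩ :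
        TangentBundle 𝓘(ℝ, (Fin n → ℝ) × (Fin m → ℝ)) Y)) (e.region Ξ) :=
    (contMDiffOn_lift A Ξ).comp
      ((contMDiffOn_symm_of_mem_maximalAtlas e.total_mem).mono fun z hz => hz.1) fun z hz => hz.2
  have h₃ := (contMDiff_snd_tangentBundle_modelSpace ((Fin n → ℝ) × (Fin m → ℝ))
    𝓘(ℝ, (Fin n → ℝ) × (Fin m → ℝ)) (n := ∞)).comp_contMDiffOn
      (h₁.comp h₂ fun z hz => e.total.map_target hz.1)
  refine h₃.congr fun z hz => ?_
  change _ = mfderivWithin _ _ _ _ _ _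
  rw [mfderivWithin_of_isOpen e.total.open_source (e.total.map_target hz.1)]
  rfl

theorem FiberedChart.isJetSmooth_horizontal (e : FiberedChart A) (Ξ : RightInvariantField B)
    (σ : Fin n) : IsJetSmooth 0 (e.region Ξ) (e.horizontal Ξ σ : Jet n m → ℝ) := by
  refine ⟨fun q => (e.components Ξ (q.1, q.2 ⟨0, zero_mem_multiIndices n 0⟩)).1 σ, ?_,
    fun _ _ => rfl⟩
  have h := (e.contDiffOn_components Ξ).comp (s := truncatedOver 0 (e.region Ξ))
    (f := fun q : (Fin n → ℝ) × (multiIndices n 0 → Fin m → ℝ) =>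
      (q.1, q.2 ⟨0, zero_mem_multiIndices n 0⟩)) (ContDiff.contDiffOn (by fun_prop))
    fun _ hq => hq
  exact (contDiff_apply ℝ ℝ σ).comp_contDiffOn h.fst

theorem FiberedChart.isJetSmooth_vertical (e : FiberedChart A) (Ξ : RightInvariantField B)
    (i : Fin m) : IsJetSmooth 1 (e.region Ξ) (e.vertical Ξ i) := by
  have hσ : ∀ σ : Fin n, (Pi.single σ 1 : Fin n → ℕ) ∈ multiIndices n 1 := fun σ => by
    rw [mem_multiIndices, ← zero_add (Pi.single σ 1), degree_add_single, degree_zero]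
  refine ⟨fun q => (e.components Ξ (q.1, q.2 ⟨0, zero_mem_multiIndices n 1⟩)).2 i -
    ∑ σ, q.2 ⟨Pi.single σ 1, hσ σ⟩ i *
      (e.components Ξ (q.1, q.2 ⟨0, zero_mem_multiIndices n 1⟩)).1 σ, ?_, fun _ _ => rfl⟩
  have h := (e.contDiffOn_components Ξ).comp (s := truncatedOver 1 (e.region Ξ))
    (f := fun q : (Fin n → ℝ) × (multiIndices n 1 → Fin m → ℝ) =>
      (q.1, q.2 ⟨0, zero_mem_multiIndices n 1⟩)) (ContDiff.contDiffOn (by fun_prop))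
    fun _ hq => hq
  refine ((contDiff_apply ℝ ℝ i).comp_contDiffOn h.snd).sub (ContDiffOn.sum fun σ _ => ?_)
  exact ContDiffOn.mul (ContDiff.contDiffOn (by fun_prop))
    ((contDiff_apply ℝ ℝ σ).comp_contDiffOn h.fst)

variable {s : ℕ} (lam : Lagrangian A s) (Ξ : RightInvariantField B)

theorem Lagrangian.bianchi_eq_neg_jacobi (i : Fin m) (e : FiberedChart A) {p : Jet n m}
    (hp : p ∈ jetsOver (e.region Ξ)) : lam.bianchi Ξ i e p = -lam.jacobi Ξ i e p :=
  sourceForm_pderivJet_eulerLagrange_eq_neg (e.isOpen_region Ξ) (e.isJetSmooth_vertical Ξ)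
    (lam.isJetSmooth_region Ξ e) i hp

theorem Lagrangian.secondVariationVanishes_iff :
    lam.SecondVariationVanishes Ξ ↔ ∀ i, VanishesOver Ξ (lam.jacobi Ξ i) :=
  (forall_congr' fun e => isLocalDivergence_hessian_iff (e.isOpen_region Ξ)
    (e.isJetSmooth_vertical Ξ) (lam.isJetSmooth_region Ξ e)).trans
      ⟨fun h i e p hp => h e i p hp, fun h e i p hp => h i e p hp⟩

variable {lam Ξ}

/-- For a symmetry, the first and second formal variations of the Lagrangian along the vertical
part are divergences, and so is the contraction of the vertical part with the Euler–Lagrange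
form. -/
theorem Lagrangian.IsSymmetry.represents (h : lam.IsSymmetry Ξ) (e : FiberedChart A) :
    ∃ (O : TopologicalSpace.Opens ((Fin n → ℝ) × (Fin m → ℝ))) (q : Fin m → smoothJets O)
      (l : smoothJets O), (O : Set _) = e.region Ξ ∧ (∀ i, Represents (e.vertical Ξ i) (q i)) ∧
      Represents (lam.coord e) l ∧ evolution q l ∈ divergences n m O ∧
      ∑ i, q i * euler O i l ∈ divergences n m O := by
  let O : TopologicalSpace.Opens ((Fin n → ℝ) × (Fin m → ℝ)) := ⟨e.region Ξ, e.isOpen_region Ξ⟩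
  choose x hx using fun σ : Fin n =>
    (show IsJetSmooth 0 O (e.horizontal Ξ σ) from e.isJetSmooth_horizontal Ξ σ).exists_represents
  choose q hq using fun i : Fin m =>
    (show IsJetSmooth 1 O (e.vertical Ξ i) from e.isJetSmooth_vertical Ξ i).exists_represents
  obtain ⟨l, hl⟩ :=
    (show IsJetSmooth s O (lam.coord e) from lam.isJetSmooth_region Ξ e).exists_represents
  exact ⟨O, q, l, rfl, hq, hl, exists_represents_of_invariant hx hq hl (h e)⟩

end Geometry
end GaugeNatural

end

/-! ### The equivalences in the two senses -/

open GaugeNatural in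
theorem mainTheorem1 {n m s : ℕ}
    {EH EW : Type*} [NormedAddCommGroup EH] [NormedSpace ℝ EH] [FiniteDimensional ℝ EH]
    [NormedAddCommGroup EW] [NormedSpace ℝ EW] [FiniteDimensional ℝ EW]
    {X H W F Y : Type*}
    [TopologicalSpace X] [ChartedSpace (Fin n → ℝ) X] [IsManifold 𝓘(ℝ, Fin n → ℝ) ∞ X]
    [TopologicalSpace H] [ChartedSpace EH H] [Group H] [LieGroup 𝓘(ℝ, EH) ∞ H]
    [TopologicalSpace W] [ChartedSpace EW W] [IsManifold 𝓘(ℝ, EW) ∞ W]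
    [TopologicalSpace F] [ChartedSpace (Fin m → ℝ) F] [IsManifold 𝓘(ℝ, Fin m → ℝ) ∞ F]
    [MulAction H F]
    (hact : ContMDiff (𝓘(ℝ, EH).prod 𝓘(ℝ, Fin m → ℝ)) 𝓘(ℝ, Fin m → ℝ) ∞
      fun q : H × F => q.1 • q.2)
    [TopologicalSpace Y] [ChartedSpace ((Fin n → ℝ) × (Fin m → ℝ)) Y]
    [IsManifold 𝓘(ℝ, (Fin n → ℝ) × (Fin m → ℝ)) ∞ Y]
    (B : PrincipalBundle n EH EW X H W) (A : AssociatedBundle m F Y B)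
    (lam : Lagrangian A s) (𝒜 : Set (RightInvariantField B))
    (hinv : lam.IsGaugeNaturalInvariant 𝒜) :
    ∀ Ξ ∈ 𝒜,
      [∀ i, VanishesOver Ξ (lam.bianchi Ξ i),
        lam.SecondVariationVanishes Ξ,
        ∀ i, VanishesOver Ξ (lam.jacobi Ξ i),
        Ξ ∈ lam.jacobiKernel].TFAE ∧
      [∀ i, VanishesOver Ξ (lam.bianchiAlong Ξ i),
        ∀ e : FiberedChart A,
          IsLocalDivergence (e.region Ξ) (lam.secondVariationAlong Ξ e),
        VanishesOver Ξ (lam.iteratedContraction Ξ),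
        ∀ i, VanishesOver Ξ (lam.jacobiAlong Ξ i),
        Ξ ∈ lam.jacobiKernelAlong].TFAE := by
  intro Ξ hΞ
  constructor
  · tfae_have 1 ↔ 3 := by
      refine forall_congr' fun i => forall_congr' fun e => forall₂_congr fun p hp => ?_
      rw [lam.bianchi_eq_neg_jacobi Ξ i e hp, neg_eq_zero]
    tfae_have 2 ↔ 3 := lam.secondVariationVanishes_iff Ξ
    tfae_have 3 ↔ 4 := Iff.rfl
    tfae_finish
  -- In sense (B) invariance makes $\mathrm{pr}_QL$ and $Q^iE_i(L)$ divergences, from which each of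
  -- the statements follows outright.
  · have hrep := (hinv Ξ hΞ).represents
    have h₁ : ∀ i, VanishesOver Ξ (lam.bianchiAlong Ξ i) := by
      intro i e
      obtain ⟨O, q, l, hO, hq, hl, -, hdiv⟩ := hrep e
      have h := (represents_contract (fun i => (hq i).neg) fun i =>
        hl.eulerLagrange i).eulerLagrange i
      rw [← hO]
      refine h.eq_zero_iff.2 (euler_eq_zero ?_ i)
      have hneg : ∑ i, -q i * euler O i l = -∑ i, q i * euler O i l := by
        rw [← Finset.sum_neg_distrib]
        exact Finset.sum_congr rfl fun i _ => neg_mul (q i) _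
      exact hneg ▸ Submodule.neg_mem _ hdiv
    have h₂ : ∀ e : FiberedChart A,
        IsLocalDivergence (e.region Ξ) (lam.secondVariationAlong Ξ e) := by
      intro e
      obtain ⟨O, q, l, hO, hq, hl, hev, -⟩ := hrep e
      rw [← hO]
      exact (Represents.prolong hq (Represents.prolong hq hl)).isLocalDivergence
        (evolution_mem_divergences q hev)
    have h₃ : VanishesOver Ξ (lam.iteratedContraction Ξ) := by
      intro e
      obtain ⟨O, q, l, hO, hq, hl, -, hdiv⟩ := hrep e
      have h := represents_contract hq fun i =>
        (represents_contract hq fun i => hl.eulerLagrange i).eulerLagrange i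
      rw [← hO]
      refine h.eq_zero_iff.2 (Finset.sum_eq_zero fun i _ => ?_)
      rw [euler_eq_zero hdiv, mul_zero]
    have h₄ : ∀ i, VanishesOver Ξ (lam.jacobiAlong Ξ i) := by
      intro i e
      obtain ⟨O, q, l, hO, hq, hl, hev, -⟩ := hrep e
      rw [← hO]
      exact ((Represents.prolong hq (Represents.prolong hq hl)).eulerLagrange i).eq_zero_iff.2
        (euler_eq_zero (evolution_mem_divergences q hev) i)
    tfae_have 1 → 2 := fun _ => h₂
    tfae_have 2 → 3 := fun _ => h₃
    tfae_have 3 → 4 := fun _ => h₄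
    tfae_have 4 ↔ 5 := Iff.rfl
    tfae_have 4 → 1 := fun _ => h₁
    tfae_finish
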